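/- There exist universal constants $C_4, C_5 > 0$ such that the following holds. Let $I_1,\dots,I_M$ and $J_1,\dots,J_N$ be natural numbers and put $m=\prod_{i=1}^M I_i$, $n=\prod_{j=1}^N J_j$, with $2\le m\le n$. Let $\mathcal U=(u_{i_1,\dots,i_N,j_1,\dots,j_N})\in\mathbb C^{J_1\times\cdots\times J_N\times J_1\times\cdots\times J_N}$ be a unitary tensor, i.e. $\mathcal U^H\star_N\mathcal U=\mathcal U\star_N\mathcal U^H=\mathcal I$ for the Einstein product $\star_N$ (contraction over $N$ shared indices), and let $\Upsilon\ge 1$ be such that $\sqrt{n}\,|u_{i_1,\dots,i_N,j_1,\dots,j_N}|\le\Upsilon$ for all indices. Let $\theta_{j_1,\dots,j_N}$ ($1\le j_k\le J_k$) be i.i.d. Bernoulli random variables with $\mathrm P(\theta=1)=m/n$ and $\mathrm P(\theta=0)=1-m/n$, let $\Pi=\{(j_1,\dots,j_N):\theta_{j_1,\dots,j_N}=1\}$, and let $\mathcal U_\Pi=\sqrt{n/m}\;\mathcal S_\Pi\star_N\mathcal U$, where $\mathcal S_\Pi$ restricts the first group of indices of $\mathcal U$ to $\Pi$. For a tensor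 $\mathcal A$ whose last $N$ dimensions are $J_1,\dots,J_N$, let $\tau_\xi(\mathcal A)$, the $\xi$-th restricted isometry constant, be the smallest $t$ such that $$(1-t)\|\mathcal X\|_{\mathrm F}^2\le\|\mathcal A\star_N\mathcal X\|_{\mathrm F}^2\le(1+t)\|\mathcal X\|_{\mathrm F}^2$$ for all $\mathcal X\in\mathbb C^{J_1\times\cdots\times J_N}$ with at most $\xi$ nonzero entries, where $\|\cdot\|_{\mathrm F}$ is the Frobenius norm. Then for every integer $\xi\ge 2$ and all $0<\tau,\eta<1$ satisfying $$m\;\ge\;\xi\,\Upsilon^2\,\tau^{-2}\max\bigl\{C_4\,\log^2\xi\,\log m\,\log n,\;C_5\log(\eta^{-1})\bigr\},$$ we have $\mathrm P\bigl(\tau_\xi(\mathcal U_\Pi)\ge\tau\bigr)\le\eta$. -/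

import Mathlib

namespace TensorRIP

/-- Multi-indices `(j₁, …, j_N)` with `j_k` ranging over `J_k` values. -/
abbrev MultiIndex {N : ℕ} (J : Fin N → ℕ) : Type := (k : Fin N) → Fin (J k)

/-- Complex tensors `X ∈ ℂ^{J₁ × ⋯ × J_N}`. -/
abbrev Tensor {N : ℕ} (J : Fin N → ℕ) : Type := MultiIndex J → ℂ

/-- Complex tensors whose dimensions are split in two groups: the entry `A p j` has a first group of
indices `p : ρ` and a second group `j = (j₁, …, j_N)`. The Einstein product over a shared group of
indices is `A * B` (respectively `A *ᵥ X` for a tensor `X` with one group of indices), the conjugate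
transpose is `Aᴴ`, and the identity tensor is `1`; see the lemmas below. The first group is an arbitrary
finite index type so that a tensor may be restricted to a set of its first indices. -/
abbrev BiTensor (ρ : Type) {N : ℕ} (J : Fin N → ℕ) : Type := Matrix ρ (MultiIndex J) ℂ

/-- The entries of the identity tensor are products of Kronecker deltas. -/
theorem identity_apply {N : ℕ} (J : Fin N → ℕ) (i j : MultiIndex J) :
    (1 : BiTensor (MultiIndex J) J) i j = ∏ k, if i k = j k then (1 : ℂ) else 0 := by
  classical
  rw [Matrix.one_apply, Finset.prod_ite_zero]
  simp [funext_iff]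

/-- The Einstein product is the contraction over all the shared indices. -/
theorem einstein_apply {ρ : Type} {N : ℕ} {J K : Fin N → ℕ}
    (A : BiTensor ρ J) (B : BiTensor (MultiIndex J) K) (p : ρ) (k : MultiIndex K) :
    (A * B) p k = ∑ j : MultiIndex J, A p j * B j k :=
  rfl

/-- Unitary tensors: `Uᴴ ⋆ U = U ⋆ Uᴴ = 1`. -/
def IsUnitaryTensor {N : ℕ} {J : Fin N → ℕ} (U : BiTensor (MultiIndex J) J) : Prop :=
  U.conjTranspose * U = 1 ∧ U * U.conjTranspose = 1

/-- The Frobenius norm of a family of complex numbers, `(∑ |x_p|²)^{1/2}`. -/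
noncomputable def frobeniusNorm {ρ : Type} [Fintype ρ] (X : ρ → ℂ) : ℝ :=
  Real.sqrt (∑ p, ‖X p‖ ^ 2)

/-- `X` is `ξ`-sparse: it has at most `ξ` nonzero entries. -/
def IsSparse {N : ℕ} {J : Fin N → ℕ} (ξ : ℕ) (X : Tensor J) : Prop :=
  (Finset.univ.filter fun j => X j ≠ 0).card ≤ ξ

/-- The real numbers `t` with `(1 - t) ‖X‖² ≤ ‖A ⋆ X‖² ≤ (1 + t) ‖X‖²` for all `ξ`-sparse `X`. -/
def isometryBounds {ρ : Type} [Fintype ρ] {N : ℕ} {J : Fin N → ℕ} (ξ : ℕ) (A : BiTensor ρ J) :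
    Set ℝ :=
  {t | ∀ X : Tensor J, IsSparse ξ X →
    (1 - t) * frobeniusNorm X ^ 2 ≤ frobeniusNorm (A.mulVec X) ^ 2 ∧
      frobeniusNorm (A.mulVec X) ^ 2 ≤ (1 + t) * frobeniusNorm X ^ 2}

/-- The `ξ`-th restricted isometry constant of `A`: the smallest element of `isometryBounds ξ A`
(it is attained, see `isLeast_restrictedIsometryConstant`). -/
noncomputable def restrictedIsometryConstant {ρ : Type} [Fintype ρ] {N : ℕ} {J : Fin N → ℕ}
    (ξ : ℕ) (A : BiTensor ρ J) : ℝ :=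
  sInf (isometryBounds ξ A)

theorem frobeniusNorm_sq {ρ : Type} [Fintype ρ] (X : ρ → ℂ) :
    frobeniusNorm X ^ 2 = ∑ p, ‖X p‖ ^ 2 :=
  Real.sq_sqrt (Finset.sum_nonneg fun _ _ => sq_nonneg _)

/-- For `ξ ≥ 1` and nonzero dimensions the restricted isometry constant is a minimum. -/
theorem isLeast_restrictedIsometryConstant {ρ : Type} [Fintype ρ] {N : ℕ} {J : Fin N → ℕ}
    [Nonempty (MultiIndex J)] {ξ : ℕ} (hξ : 1 ≤ ξ) (A : BiTensor ρ J) :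
    IsLeast (isometryBounds ξ A) (restrictedIsometryConstant ξ A) := by
  have hclosed : IsClosed (isometryBounds ξ A) := by
    have h : isometryBounds ξ A = ⋂ X : Tensor J, ⋂ _ : IsSparse ξ X,
        {t : ℝ | (1 - t) * frobeniusNorm X ^ 2 ≤ frobeniusNorm (A.mulVec X) ^ 2} ∩
          {t : ℝ | frobeniusNorm (A.mulVec X) ^ 2 ≤ (1 + t) * frobeniusNorm X ^ 2} := by
      ext t
      simp [isometryBounds]
    rw [h]
    refine isClosed_iInter fun X => isClosed_iInter fun _ => ?_
    exact (isClosed_le (by fun_prop) (by fun_prop)).inter (isClosed_le (by fun_prop) (by fun_prop))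
  have hbdd : BddBelow (isometryBounds ξ A) := by
    refine ⟨0, fun t ht => ?_⟩
    obtain ⟨j₀⟩ := ‹Nonempty (MultiIndex J)›
    have hs : IsSparse ξ (Pi.single j₀ 1 : Tensor J) := by
      have : (Finset.univ.filter fun j => (Pi.single j₀ 1 : Tensor J) j ≠ 0) ⊆ {j₀} := by
        intro j hj
        simp only [Finset.mem_filter, Finset.mem_univ, true_and] at hj
        by_contra hne
        exact hj (Pi.single_eq_of_ne (by simpa using hne) _)
      exact (Finset.card_le_card this).trans (by simpa using hξ)
    have hn : frobeniusNorm (Pi.single j₀ 1 : Tensor J) ^ 2 = 1 := by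
      rw [frobeniusNorm_sq, Finset.sum_eq_single j₀]
      · simp
      · intro j _ hj
        simp [Pi.single_eq_of_ne hj]
      · simp
    have h := ht _ hs
    rw [hn] at h
    linarith [h.1, h.2]
  have hne : (isometryBounds ξ A).Nonempty := by
    refine ⟨1 + ∑ p, ∑ j, ‖A p j‖ ^ 2, fun X _ => ?_⟩
    have h0 : 0 ≤ frobeniusNorm X ^ 2 := sq_nonneg _
    have h1 : 0 ≤ ∑ p, ∑ j, ‖A p j‖ ^ 2 :=
      Finset.sum_nonneg fun _ _ => Finset.sum_nonneg fun _ _ => sq_nonneg _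
    have h2 : frobeniusNorm (A.mulVec X) ^ 2 ≤
        (∑ p, ∑ j, ‖A p j‖ ^ 2) * frobeniusNorm X ^ 2 := by
      rw [frobeniusNorm_sq, frobeniusNorm_sq, Finset.sum_mul]
      refine Finset.sum_le_sum fun p _ => ?_
      calc ‖A.mulVec X p‖ ^ 2 ≤ (∑ j, ‖A p j‖ * ‖X j‖) ^ 2 := by
            refine pow_le_pow_left₀ (norm_nonneg _) ?_ 2
            refine (norm_sum_le _ _).trans (Finset.sum_le_sum fun j _ => ?_)
            exact norm_mul_le _ _
        _ ≤ _ := Finset.sum_mul_sq_le_sq_mul_sq _ _ _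
    constructor
    · nlinarith [sq_nonneg (frobeniusNorm (A.mulVec X)), mul_nonneg h1 h0]
    · nlinarith
  exact ⟨hclosed.csInf_mem hne hbdd, fun t ht => csInf_le hbdd ht⟩

/-- The restriction `S_Π` to the entries in `Π`, as a tensor: its entry at `(p, j)`, `p ∈ Π`, is `1` if
`p = j` and `0` otherwise, so that `(S_Π ⋆ U) p k = U p k` for `p ∈ Π`. -/
def restrictionTensor {N : ℕ} {J : Fin N → ℕ} (P : Finset (MultiIndex J)) : BiTensor P J :=
  fun p j => if (p : MultiIndex J) = j then 1 else 0

theorem restrictionTensor_mul_apply {N : ℕ} {J : Fin N → ℕ} (P : Finset (MultiIndex J))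
    (U : BiTensor (MultiIndex J) J) (p : P) (k : MultiIndex J) :
    (restrictionTensor P * U) p k = U p k := by
  simp [Matrix.mul_apply, restrictionTensor]

/-- The normalized sampled tensor `U_Π = (∏ J_j / ∏ I_i)^{1/2} S_Π ⋆ U`. -/
noncomputable def sampledTensor {M N : ℕ} (I : Fin M → ℕ) {J : Fin N → ℕ}
    (P : Finset (MultiIndex J)) (U : BiTensor (MultiIndex J) J) : BiTensor P J :=
  ((Real.sqrt ((∏ j, (J j : ℝ)) / ∏ i, (I i : ℝ)) : ℝ) : ℂ) • (restrictionTensor P * U)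

/-- The random set `Π = {j : θ_j = 1}` of selected indices. -/
noncomputable def selectedSet {Ω : Type*} {N : ℕ} {J : Fin N → ℕ} (θ : MultiIndex J → Ω → ℝ)
    (ω : Ω) : Finset (MultiIndex J) :=
  Finset.univ.filter fun j => θ j ω = 1

/-- `(θ_j)` are independent random selectors on `(Ω, μ)`, each with the Bernoulli distribution of
parameter `q`. -/
structure IsBernoulliSelectors {Ω : Type*} [MeasurableSpace Ω] (μ : MeasureTheory.Measure Ω)
    {N : ℕ} {J : Fin N → ℕ} (q : ℝ) (θ : MultiIndex J → Ω → ℝ) : Prop where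
  measurable : ∀ j, Measurable (θ j)
  indep : ProbabilityTheory.iIndepFun θ μ
  prob_one : ∀ j, μ.real {ω | θ j ω = 1} = q
  prob_zero : ∀ j, μ.real {ω | θ j ω = 0} = 1 - q

end TensorRIP

/-!
The restricted isometry constant of `U_Π` is the supremum over sparse unit vectors `x` of the centred
quadratic process `∑ j, (θ j - m / n) * (n / m) * ‖(U x) j‖ ^ 2`, since `U` preserves the norm. Its tail
is obtained from its moments of an order `2 p` with `p` about `log (1 / η)`, along the lines of Rudelson
and Vershynin. Only the law of the pattern of the selectors matters, so that all the expectations are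
finite sums over Boolean patterns, and the supremum is taken over a grid of sparse vectors so fine that a
crude Lipschitz bound (`abs_quadratic_le_of_sparseGrid`) recovers all of them; the logarithm of the number
of its points is still `O(ξ log n)`.

After symmetrization (`bernoulliExp_symmetrization`) the process is, conditionally on the sample, a
sum with random signs. The difference of its values at `x` and `y` has variance at most the energy of `x`
and `y` on the sample times the square of the largest sampled entry of `√(n / m) U (x - y)`
(`sum_indic_sq_sub_sq_le`). For this supremum norm, sparse vectors are approximated by averages of few
multiples of basis vectors (Maurey's method, `exists_representatives`), where the sampling argument is
replaced by a greedy choice which keeps an exponential potential small. Chaining through `O(log ξ)`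
such scales, down to one below `ξ ^ (-1 / 2)`, where the number of grid points is small enough for a direct union
bound, gives `bernoulliExp_half_quadratic_process_le`: with `b = ξ Υ ^ 2 / m`, the conditional `2 p`-th
moment is at most `(C b W (p + log ^ 2 ξ * log |Π| * log n)) ^ p`, up to a constant factor. Here `W` bounds
the energies on the sample. The term `p` is not multiplied by logarithms because the scales decay
geometrically.

The energy is at most the supremum `Z` of the centred process plus a constant, and `log |Π|` is comparable
to `log m` in all moments of order at most `m`. The Cauchy-Schwarz inequality thus yields an inequality for
the moment of `Z` in terms of itself, which is solved in `bernoulliExp_quadratic_process_le`. Markov's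
inequality then turns `b (p + log ^ 2 ξ * log m * log n) ≤ c τ ^ 2` into the tail `exp (-p) ≤ η`.
-/

set_option linter.unusedSectionVars false

namespace TensorRIP

/-! ### Finite Bernoulli expectations and symmetrization -/

section Expectation

variable {ι : Type*} [Fintype ι] [DecidableEq ι]

/-- The probability of the pattern `ω` of independent Bernoulli variables of parameter `q`. -/
noncomputable def bernoulliWeight (q : ℝ) (ω : ι → Bool) : ℝ :=
  ∏ j, if ω j = true then q else 1 - q

/-- The expectation of `f` under the product Bernoulli law of parameter `q` on `ι → Bool`, as a finite
sum. For `q = 1/2` this is the expectation over uniform random signs. -/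
noncomputable def bernoulliExp (q : ℝ) (f : (ι → Bool) → ℝ) : ℝ :=
  ∑ ω, bernoulliWeight q ω * f ω

/-- The `0`-`1` value of a Boolean. -/
def indic (b : Bool) : ℝ := if b = true then 1 else 0

/-- The sign of a Boolean: `1` for `true` and `-1` for `false`. -/
def sgn (b : Bool) : ℝ := if b = true then 1 else -1

theorem abs_sgn (b : Bool) : |sgn b| = 1 := by cases b <;> simp [sgn]

theorem bernoulliWeight_nonneg {q : ℝ} (h0 : 0 ≤ q) (h1 : q ≤ 1) (ω : ι → Bool) :
    0 ≤ bernoulliWeight q ω := by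
  refine Finset.prod_nonneg fun j _ => ?_
  split_ifs <;> linarith

theorem bernoulliExp_prod (q : ℝ) (g : ι → Bool → ℝ) :
    bernoulliExp q (fun ω => ∏ j, g j (ω j)) = ∏ j, (q * g j true + (1 - q) * g j false) := by
  have h : ∀ j, q * g j true + (1 - q) * g j false
      = ∑ b : Bool, (if b = true then q else 1 - q) * g j b := by
    intro j; simp
  simp_rw [h, Finset.prod_univ_sum, bernoulliExp, bernoulliWeight, ← Finset.prod_mul_distrib,
    Fintype.piFinset_univ]

theorem sum_bernoulliWeight (q : ℝ) : ∑ ω : ι → Bool, bernoulliWeight q ω = 1 := by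
  have := bernoulliExp_prod (ι := ι) q (fun _ _ => 1)
  simpa [bernoulliExp] using this

theorem bernoulliExp_const (q c : ℝ) : bernoulliExp (ι := ι) q (fun _ => c) = c := by
  rw [bernoulliExp, ← Finset.sum_mul, sum_bernoulliWeight, one_mul]

theorem bernoulliExp_mono {q : ℝ} (h0 : 0 ≤ q) (h1 : q ≤ 1) {f g : (ι → Bool) → ℝ}
    (h : ∀ ω, f ω ≤ g ω) : bernoulliExp q f ≤ bernoulliExp q g :=
  Finset.sum_le_sum fun ω _ => mul_le_mul_of_nonneg_left (h ω) (bernoulliWeight_nonneg h0 h1 ω)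

theorem bernoulliExp_nonneg {q : ℝ} (h0 : 0 ≤ q) (h1 : q ≤ 1) {f : (ι → Bool) → ℝ}
    (h : ∀ ω, 0 ≤ f ω) : 0 ≤ bernoulliExp q f :=
  Finset.sum_nonneg fun ω _ => mul_nonneg (bernoulliWeight_nonneg h0 h1 ω) (h ω)

theorem bernoulliExp_add (q : ℝ) (f g : (ι → Bool) → ℝ) :
    bernoulliExp q (fun ω => f ω + g ω) = bernoulliExp q f + bernoulliExp q g := by
  simp [bernoulliExp, mul_add, Finset.sum_add_distrib]

theorem bernoulliExp_mul_left (q c : ℝ) (f : (ι → Bool) → ℝ) :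
    bernoulliExp q (fun ω => c * f ω) = c * bernoulliExp q f := by
  rw [bernoulliExp, bernoulliExp, Finset.mul_sum]
  exact Finset.sum_congr rfl fun ω _ => by ring

theorem bernoulliExp_sum {κ : Type*} (s : Finset κ) (q : ℝ) (f : κ → (ι → Bool) → ℝ) :
    bernoulliExp q (fun ω => ∑ k ∈ s, f k ω) = ∑ k ∈ s, bernoulliExp q (f k) := by
  simp only [bernoulliExp, Finset.mul_sum]
  exact Finset.sum_comm

theorem bernoulliExp_comm (q q' : ℝ) (f : (ι → Bool) → (ι → Bool) → ℝ) :
    bernoulliExp q (fun ω => bernoulliExp q' fun ω' => f ω ω')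
      = bernoulliExp q' fun ω' => bernoulliExp q fun ω => f ω ω' := by
  simp only [bernoulliExp, Finset.mul_sum]
  rw [Finset.sum_comm]
  exact Finset.sum_congr rfl fun _ _ => Finset.sum_congr rfl fun _ _ => by ring

theorem bernoulliExp_indic (q : ℝ) (j : ι) : bernoulliExp q (fun ω => indic (ω j)) = q := by
  have h := bernoulliExp_prod q (fun i b => if i = j then indic b else 1)
  have h1 : ∀ ω : ι → Bool, (∏ i, if i = j then indic (ω i) else 1) = indic (ω j) := by
    intro ω; simp
  simp only [h1] at h
  rw [h, Finset.prod_eq_single j]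
  · simp [indic]
  · intro i _ hi; simp [hi]
  · simp

theorem bernoulliExp_cauchySchwarz {q : ℝ} (h0 : 0 ≤ q) (h1 : q ≤ 1) (f g : (ι → Bool) → ℝ) :
    bernoulliExp q (fun ω => f ω * g ω) ^ 2
      ≤ bernoulliExp q (fun ω => f ω ^ 2) * bernoulliExp q (fun ω => g ω ^ 2) := by
  have h := Finset.sum_mul_sq_le_sq_mul_sq Finset.univ
    (fun ω : ι → Bool => √(bernoulliWeight q ω) * f ω) (fun ω => √(bernoulliWeight q ω) * g ω)
  have hs : ∀ ω : ι → Bool, √(bernoulliWeight q ω) ^ 2 = bernoulliWeight q ω :=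
    fun ω => Real.sq_sqrt (bernoulliWeight_nonneg h0 h1 ω)
  simp only [mul_pow, hs] at h
  refine le_trans (le_of_eq ?_) h
  simp only [bernoulliExp]
  congr 1
  refine Finset.sum_congr rfl fun ω _ => ?_
  nth_rewrite 1 [← hs]
  ring

theorem bernoulliExp_markov {q : ℝ} (h0 : 0 ≤ q) (h1 : q ≤ 1) {f : (ι → Bool) → ℝ}
    (hf : ∀ ω, 0 ≤ f ω) {t : ℝ} (ht : 0 < t) (s : Finset (ι → Bool)) (hs : ∀ ω ∈ s, t ≤ f ω) :
    ∑ ω ∈ s, bernoulliWeight q ω ≤ bernoulliExp q f / t := by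
  rw [le_div_iff₀ ht, Finset.sum_mul]
  refine (Finset.sum_le_sum fun ω hω => mul_le_mul_of_nonneg_left (hs ω hω)
    (bernoulliWeight_nonneg h0 h1 ω)).trans ?_
  exact Finset.sum_le_sum_of_subset_of_nonneg (Finset.subset_univ s)
    fun ω _ _ => mul_nonneg (bernoulliWeight_nonneg h0 h1 ω) (hf ω)

variable {E : Type*} [NormedAddCommGroup E] [NormedSpace ℝ E]

theorem norm_sum_bernoulliWeight_smul_pow_le {q : ℝ} (h0 : 0 ≤ q) (h1 : q ≤ 1)
    (v : (ι → Bool) → E) (p : ℕ) :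
    ‖∑ ω, bernoulliWeight q ω • v ω‖ ^ p ≤ bernoulliExp q (fun ω => ‖v ω‖ ^ p) := by
  have h := Real.pow_arith_mean_le_arith_mean_pow Finset.univ (bernoulliWeight (ι := ι) q)
    (fun ω => ‖v ω‖) (fun ω _ => bernoulliWeight_nonneg h0 h1 ω) (sum_bernoulliWeight q)
    (fun ω _ => norm_nonneg _) p
  refine (pow_le_pow_left₀ (norm_nonneg _) ?_ p).trans h
  refine (norm_sum_le _ _).trans (le_of_eq (Finset.sum_congr rfl fun ω _ => ?_))
  rw [norm_smul, Real.norm_of_nonneg (bernoulliWeight_nonneg h0 h1 ω)]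

/-- Exchanging the coordinates selected by `ε` between two patterns. -/
def swapCoords (ε : ι → Bool) (x : (ι → Bool) × (ι → Bool)) : (ι → Bool) × (ι → Bool) :=
  (fun j => if ε j = true then x.1 j else x.2 j, fun j => if ε j = true then x.2 j else x.1 j)

theorem swapCoords_involutive (ε : ι → Bool) : Function.Involutive (swapCoords ε) := by
  intro x
  ext j <;> by_cases h : ε j = true <;> simp [swapCoords, h]

/-- Two independent patterns with coordinates exchanged are again two independent patterns. -/
theorem bernoulliExp_swapCoords (q : ℝ) (ε : ι → Bool) (f : (ι → Bool) → (ι → Bool) → ℝ) :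
    bernoulliExp q (fun ω => bernoulliExp q fun ω' => f ω ω')
      = bernoulliExp q (fun ω => bernoulliExp q fun ω' =>
          f (swapCoords ε (ω, ω')).1 (swapCoords ε (ω, ω')).2) := by
  have hw : ∀ x : (ι → Bool) × (ι → Bool),
      bernoulliWeight q (swapCoords ε x).1 * bernoulliWeight q (swapCoords ε x).2
        = bernoulliWeight q x.1 * bernoulliWeight q x.2 := by
    intro x
    simp only [bernoulliWeight, ← Finset.prod_mul_distrib]
    refine Finset.prod_congr rfl fun j _ => ?_
    by_cases h : ε j = true <;> simp [swapCoords, h, mul_comm]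
  have key : ∀ g : (ι → Bool) → (ι → Bool) → ℝ,
      bernoulliExp q (fun ω => bernoulliExp q fun ω' => g ω ω')
        = ∑ x : (ι → Bool) × (ι → Bool),
          bernoulliWeight q x.1 * bernoulliWeight q x.2 * g x.1 x.2 := by
    intro g
    rw [Fintype.sum_prod_type]
    simp only [bernoulliExp, Finset.mul_sum, mul_assoc]
  rw [key, key, ← Equiv.sum_comp (swapCoords_involutive ε).toPerm]
  refine Finset.sum_congr rfl fun x _ => ?_
  simp only [Function.Involutive.coe_toPerm, hw]

/-- Symmetrization: the centred sums are dominated, in every moment, by sums with random signs. -/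
theorem bernoulliExp_symmetrization {q : ℝ} (h0 : 0 ≤ q) (h1 : q ≤ 1) (v : ι → E) {p : ℕ} (hp : p ≠ 0) :
    bernoulliExp q (fun ω => ‖∑ j, (indic (ω j) - q) • v j‖ ^ p)
      ≤ 2 ^ p * bernoulliExp q (fun ω => bernoulliExp (1 / 2) fun ε =>
          ‖∑ j, (sgn (ε j) * indic (ω j)) • v j‖ ^ p) := by
  have hh0 : (0 : ℝ) ≤ 1 / 2 := by norm_num
  have hh1 : (1 / 2 : ℝ) ≤ 1 := by norm_num
  -- Centring by an independent copy, and Jensen's inequality.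
  have step1 : bernoulliExp q (fun ω => ‖∑ j, (indic (ω j) - q) • v j‖ ^ p)
      ≤ bernoulliExp q (fun ω => bernoulliExp q fun ω' =>
          ‖∑ j, (indic (ω j) - indic (ω' j)) • v j‖ ^ p) := by
    refine bernoulliExp_mono h0 h1 fun ω => ?_
    have : ∑ j, (indic (ω j) - q) • v j
        = ∑ ω', bernoulliWeight q ω' • ∑ j, (indic (ω j) - indic (ω' j)) • v j := by
      simp only [Finset.smul_sum, smul_smul]
      rw [Finset.sum_comm]
      refine Finset.sum_congr rfl fun j _ => ?_
      rw [← Finset.sum_smul]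
      congr 1
      have := bernoulliExp_indic q j
      rw [bernoulliExp] at this
      simp only [mul_sub, Finset.sum_sub_distrib, this, ← Finset.sum_mul, sum_bernoulliWeight,
        one_mul]
    rw [this]
    exact norm_sum_bernoulliWeight_smul_pow_le h0 h1 _ p
  have step2 : ∀ ε : ι → Bool, bernoulliExp q (fun ω => bernoulliExp q fun ω' =>
        ‖∑ j, (indic (ω j) - indic (ω' j)) • v j‖ ^ p)
      = bernoulliExp q (fun ω => bernoulliExp q fun ω' =>
        ‖∑ j, (sgn (ε j) * (indic (ω j) - indic (ω' j))) • v j‖ ^ p) := by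
    intro ε
    rw [bernoulliExp_swapCoords q ε]
    congr 1
    funext ω
    congr 1
    funext ω'
    congr 2
    refine Finset.sum_congr rfl fun j _ => ?_
    by_cases h : ε j = true <;> simp [swapCoords, sgn, h]
  have step3 : ∀ ω ω' ε : ι → Bool, ‖∑ j, (sgn (ε j) * (indic (ω j) - indic (ω' j))) • v j‖ ^ p
      ≤ 2 ^ (p - 1) * (‖∑ j, (sgn (ε j) * indic (ω j)) • v j‖ ^ p
        + ‖∑ j, (sgn (ε j) * indic (ω' j)) • v j‖ ^ p) := by
    intro ω ω' ε
    have : ∑ j, (sgn (ε j) * (indic (ω j) - indic (ω' j))) • v j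
        = ∑ j, (sgn (ε j) * indic (ω j)) • v j - ∑ j, (sgn (ε j) * indic (ω' j)) • v j := by
      rw [← Finset.sum_sub_distrib]
      exact Finset.sum_congr rfl fun j _ => by rw [mul_sub, sub_smul]
    rw [this]
    exact (pow_le_pow_left₀ (norm_nonneg _) (norm_sub_le _ _) p).trans
      (add_pow_le (norm_nonneg _) (norm_nonneg _) p)
  set R := bernoulliExp q (fun ω => bernoulliExp (1 / 2) fun ε =>
          ‖∑ j, (sgn (ε j) * indic (ω j)) • v j‖ ^ p) with hR
  have hR0 : 0 ≤ R := bernoulliExp_nonneg h0 h1 fun _ => bernoulliExp_nonneg hh0 hh1 fun _ => by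
    positivity
  calc _ ≤ _ := step1
    _ = bernoulliExp (1 / 2) (fun ε => bernoulliExp q (fun ω => bernoulliExp q fun ω' =>
        ‖∑ j, (sgn (ε j) * (indic (ω j) - indic (ω' j))) • v j‖ ^ p)) := by
          simp only [← step2, bernoulliExp_const]
    _ ≤ bernoulliExp (1 / 2) (fun ε => bernoulliExp q (fun ω => bernoulliExp q fun ω' =>
        2 ^ (p - 1) * (‖∑ j, (sgn (ε j) * indic (ω j)) • v j‖ ^ p
        + ‖∑ j, (sgn (ε j) * indic (ω' j)) • v j‖ ^ p))) :=
          bernoulliExp_mono hh0 hh1 fun ε => bernoulliExp_mono h0 h1 fun ω =>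
            bernoulliExp_mono h0 h1 fun ω' => step3 ω ω' ε
    _ = 2 ^ (p - 1) * (R + R) := by
          simp only [bernoulliExp_mul_left, bernoulliExp_add, bernoulliExp_const]
          rw [hR, bernoulliExp_comm q (1 / 2)]
    _ ≤ 2 ^ p * R := by
          obtain ⟨k, rfl⟩ := Nat.exists_eq_succ_of_ne_zero hp
          rw [pow_succ, Nat.succ_sub_one]
          linarith
end Expectation

/-! ### Moments of maxima of random sign sums, and chaining -/

section Chaining

variable {ι : Type*} [Fintype ι] [DecidableEq ι]

theorem bernoulliExp_half_exp_le (c : ι → ℝ) (s : ℝ) :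
    bernoulliExp (1 / 2) (fun ε => Real.exp (s * ∑ j, sgn (ε j) * c j))
      ≤ Real.exp (s ^ 2 * (∑ j, c j ^ 2) / 2) := by
  have h := bernoulliExp_prod (1 / 2 : ℝ) (fun (j : ι) b => Real.exp (s * (sgn b * c j)))
  simp only [← Real.exp_sum, ← Finset.mul_sum] at h
  rw [h, Finset.mul_sum, Finset.sum_div, Real.exp_sum]
  refine Finset.prod_le_prod (fun j _ => by positivity) fun j _ => ?_
  refine le_trans (le_of_eq ?_) ((Real.cosh_le_exp_half_sq (s * c j)).trans (le_of_eq ?_))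
  · simp only [sgn, Real.cosh_eq, if_true, Bool.false_eq_true, if_false]
    ring_nf
  · ring_nf

/-- Khintchine's inequality for even moments, from the exponential moment at `s ^ 2 = 2 r / σ ^ 2`. -/
theorem bernoulliExp_half_pow_le (c : ι → ℝ) {v : ℝ} (hv : 0 < v) (hc : ∑ j, c j ^ 2 ≤ v) {r : ℕ}
    (hr : r ≠ 0) :
    bernoulliExp (1 / 2) (fun ε => (∑ j, sgn (ε j) * c j) ^ (2 * r))
      ≤ 2 * (2 * Real.exp 1 * r * v) ^ r := by
  have hh0 : (0 : ℝ) ≤ 1 / 2 := by norm_num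
  have hh1 : (1 / 2 : ℝ) ≤ 1 := by norm_num
  have hr0 : (0 : ℝ) < r := by exact_mod_cast Nat.pos_of_ne_zero hr
  set s : ℝ := √(2 * r / v) with hs
  have hs2 : s ^ 2 = 2 * r / v := Real.sq_sqrt (by positivity)
  have hs0 : 0 < s := Real.sqrt_pos.2 (by positivity)
  -- The elementary bound `z ^ (2 r) ≤ (2 r) ^ (2 r) exp z` at `z = s |y|`.
  have hpt : ∀ y : ℝ, y ^ (2 * r) ≤ (2 * r * v) ^ r * (Real.exp (s * y) + Real.exp (-s * y)) := by
    intro y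
    have h1 : s * |y| / (2 * r) ≤ Real.exp (s * |y| / (2 * r)) :=
      (by linarith [Real.add_one_le_exp (s * |y| / (2 * r))])
    have h2 := pow_le_pow_left₀ (by positivity) h1 (2 * r)
    rw [← Real.exp_nat_mul] at h2
    have h3 : ((2 * r : ℕ) : ℝ) * (s * |y| / (2 * r)) = s * |y| := by
      push_cast; field_simp
    rw [h3, div_pow, div_le_iff₀ (by positivity), mul_pow, pow_mul s, hs2] at h2
    have h4 : (|y|) ^ (2 * r) = y ^ (2 * r) := by rw [pow_mul, sq_abs, ← pow_mul]
    rw [h4, div_pow, div_mul_eq_mul_div, div_le_iff₀ (by positivity)] at h2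
    have h5 : Real.exp (s * |y|) ≤ Real.exp (s * y) + Real.exp (-s * y) := by
      rcases abs_cases y with ⟨h, _⟩ | ⟨h, _⟩ <;> rw [h]
      · linarith [Real.exp_pos (-s * y)]
      · rw [mul_neg, ← neg_mul]; linarith [Real.exp_pos (s * y)]
    have h6 : (2 * r : ℝ) ^ r * y ^ (2 * r)
        ≤ (2 * r : ℝ) ^ r * ((2 * r * v) ^ r * Real.exp (s * |y|)) := by
      refine h2.trans (le_of_eq ?_)
      rw [mul_pow (2 * (r : ℝ)) v, pow_mul, sq, mul_pow]; ring
    exact (le_of_mul_le_mul_left h6 (by positivity)).trans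
      (mul_le_mul_of_nonneg_left h5 (by positivity))
  refine (bernoulliExp_mono hh0 hh1 fun ε => hpt _).trans ?_
  rw [bernoulliExp_mul_left, bernoulliExp_add]
  have e1 := bernoulliExp_half_exp_le c s
  have e2 := bernoulliExp_half_exp_le c (-s)
  have e3 : Real.exp (s ^ 2 * (∑ j, c j ^ 2) / 2) ≤ Real.exp 1 ^ r := by
    rw [← Real.exp_nat_mul, mul_one]
    refine Real.exp_le_exp.2 ?_
    rw [hs2]
    calc 2 * r / v * (∑ j, c j ^ 2) / 2 ≤ 2 * r / v * v / 2 := by gcongr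
      _ = r := by field_simp
  rw [neg_sq] at e2
  calc _ ≤ (2 * r * v) ^ r * (Real.exp 1 ^ r + Real.exp 1 ^ r) := by
        gcongr <;> linarith
    _ = _ := by
        rw [show 2 * Real.exp 1 * r * v = 2 * r * v * Real.exp 1 by ring, mul_pow]; ring

/-- Moments of the maximum of at most `exp r` Rademacher sums of variance at most `v`: a `2 p`-th
moment is estimated through the `2 r`-th moments of all the sums. -/
theorem bernoulliExp_half_max_pow_le {κ : Type*} (L : Finset κ) (c : κ → ι → ℝ) {v : ℝ}
    (hv : 0 < v) (hc : ∀ l ∈ L, ∑ j, c l j ^ 2 ≤ v) {p r : ℕ} (hp : p ≠ 0) (hpr : p ≤ r)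
    (hL : (L.card : ℝ) ≤ Real.exp r) (D : (ι → Bool) → ℝ) (hD0 : ∀ ε, 0 ≤ D ε)
    (hD : ∀ ε, ∃ l ∈ L, D ε ≤ |∑ j, sgn (ε j) * c l j|) :
    bernoulliExp (1 / 2) (fun ε => D ε ^ (2 * p)) ≤ 3 * (2 * Real.exp 1 ^ 2 * r * v) ^ p := by
  have hh0 : (0 : ℝ) ≤ 1 / 2 := by norm_num
  have hh1 : (1 / 2 : ℝ) ≤ 1 := by norm_num
  have hr : r ≠ 0 := by omega
  have hr0 : (0 : ℝ) < r := by exact_mod_cast Nat.pos_of_ne_zero hr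
  set R : ℝ := 2 * Real.exp 1 ^ 2 * r * v with hR
  have hR0 : 0 < R := by positivity
  have hpt : ∀ ε, D ε ^ (2 * p)
      ≤ R ^ p * (1 + (R ^ r)⁻¹ * ∑ l ∈ L, (∑ j, sgn (ε j) * c l j) ^ (2 * r)) := by
    intro ε
    obtain ⟨l, hl, hle⟩ := hD ε
    have hDr : D ε ^ (2 * r) ≤ ∑ l ∈ L, (∑ j, sgn (ε j) * c l j) ^ (2 * r) := by
      refine le_trans ?_ (Finset.single_le_sum (f := fun l => (∑ j, sgn (ε j) * c l j) ^ (2 * r))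
        (fun l _ => by rw [pow_mul]; positivity) hl)
      refine (pow_le_pow_left₀ (hD0 ε) hle _).trans (le_of_eq ?_)
      rw [pow_mul, sq_abs, ← pow_mul]
    set t := D ε ^ 2 / R with ht
    have ht0 : 0 ≤ t := by positivity
    have htp : t ^ p ≤ 1 + t ^ r := by
      rcases le_total t 1 with h | h
      · exact (pow_le_one₀ ht0 h).trans (by linarith [pow_nonneg ht0 r])
      · linarith [pow_le_pow_right₀ h hpr]
    have hDt : ∀ k : ℕ, D ε ^ (2 * k) = R ^ k * t ^ k := by
      intro k
      rw [← mul_pow, ht, mul_div_cancel₀ _ hR0.ne', pow_mul]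
    rw [hDt p]
    refine mul_le_mul_of_nonneg_left (htp.trans ?_) (by positivity)
    have : t ^ r = (R ^ r)⁻¹ * D ε ^ (2 * r) := by
      rw [hDt r, inv_mul_cancel_left₀ (by positivity)]
    rw [this]
    gcongr
  refine (bernoulliExp_mono hh0 hh1 hpt).trans ?_
  rw [bernoulliExp_mul_left, bernoulliExp_add, bernoulliExp_const, bernoulliExp_mul_left,
    bernoulliExp_sum]
  have hsum : ∑ l ∈ L, bernoulliExp (1 / 2) (fun ε => (∑ j, sgn (ε j) * c l j) ^ (2 * r))
      ≤ 2 * R ^ r := by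
    calc _ ≤ ∑ l ∈ L, 2 * (2 * Real.exp 1 * r * v) ^ r :=
          Finset.sum_le_sum fun l hl => bernoulliExp_half_pow_le (c l) hv (hc l hl) hr
      _ = L.card * (2 * (2 * Real.exp 1 * r * v) ^ r) := by rw [Finset.sum_const, nsmul_eq_mul]
      _ ≤ Real.exp r * (2 * (2 * Real.exp 1 * r * v) ^ r) := by gcongr
      _ = 2 * R ^ r := by
          rw [hR, show 2 * Real.exp 1 ^ 2 * r * v = Real.exp 1 * (2 * Real.exp 1 * r * v) by ring,
            mul_pow (Real.exp 1), ← Real.exp_nat_mul, mul_one]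
          ring
  have : (R ^ r)⁻¹ * ∑ l ∈ L, bernoulliExp (1 / 2) (fun ε => (∑ j, sgn (ε j) * c l j) ^ (2 * r))
      ≤ 2 := by
    rw [inv_mul_le_iff₀ (by positivity)]; linarith
  nlinarith [pow_pos hR0 p]

/-- Jensen's inequality for a sum whose terms are of the respective sizes `c k`. -/
theorem sum_pow_le_of_sizes {n : ℕ} (hn : n ≠ 0) (c t : ℕ → ℝ) (hc : ∀ k < n, 0 < c k)
    (ht : ∀ k < n, 0 ≤ t k) (p : ℕ) :
    (∑ k ∈ Finset.range n, t k) ^ p ≤ (∑ k ∈ Finset.range n, c k) ^ p *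
      ∑ k ∈ Finset.range n, (c k / ∑ i ∈ Finset.range n, c i) * (t k / c k) ^ p := by
  set s := ∑ i ∈ Finset.range n, c i with hs
  have hs0 : 0 < s := Finset.sum_pos (fun k hk => hc k (Finset.mem_range.1 hk))
    (Finset.nonempty_range_iff.2 hn)
  have h := Real.pow_arith_mean_le_arith_mean_pow (Finset.range n) (fun k => c k / s)
    (fun k => t k / c k) (fun k hk => (div_pos (hc k (Finset.mem_range.1 hk)) hs0).le)
    (by rw [← Finset.sum_div, ← hs, div_self hs0.ne'])
    (fun k hk => div_nonneg (ht k (Finset.mem_range.1 hk)) (hc k (Finset.mem_range.1 hk)).le) p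
  have e : ∑ k ∈ Finset.range n, c k / s * (t k / c k) = (∑ k ∈ Finset.range n, t k) / s := by
    rw [Finset.sum_div]
    refine Finset.sum_congr rfl fun k hk => ?_
    have := (hc k (Finset.mem_range.1 hk)).ne'
    field_simp
  rw [e, div_pow, div_le_iff₀ (by positivity)] at h
  linarith

/-- Chaining. The points of `T` are joined to a point where the process vanishes through the
approximations `σ 0 x, …, σ n x = x`; the `k`-th links are at most `exp (r k)` in number, have variance at
most `v k`, and contribute the size `c k ≥ √(r k * v k)` to the supremum. -/
theorem bernoulliExp_half_chaining {T : Type*} [Fintype T] [Nonempty T] [DecidableEq T]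
    (h : T → ι → ℝ)
    {n : ℕ} (hn : n ≠ 0) (σ : ℕ → T → T) (hσ0 : ∀ x, h (σ 0 x) = 0) (hσn : ∀ x, σ n x = x) {p : ℕ}
    (hp : p ≠ 0) (r : ℕ → ℕ) (v c : ℕ → ℝ) (hr : ∀ k < n, p ≤ r k) (hv : ∀ k < n, 0 < v k)
    (hc : ∀ k < n, 0 < c k) (hrv : ∀ k < n, r k * v k ≤ c k ^ 2)
    (hvar : ∀ k < n, ∀ x, ∑ j, (h (σ (k + 1) x) j - h (σ k x) j) ^ 2 ≤ v k)
    (hcard : ∀ k < n, ((Finset.univ.image fun x => (σ k x, σ (k + 1) x)).card : ℝ)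
      ≤ Real.exp (r k)) :
    bernoulliExp (1 / 2) (fun ε => ‖fun x => ∑ j, sgn (ε j) * h x j‖ ^ (2 * p))
      ≤ 3 * (2 * Real.exp 1 ^ 2) ^ p * (∑ k ∈ Finset.range n, c k) ^ (2 * p) := by
  have hh0 : (0 : ℝ) ≤ 1 / 2 := by norm_num
  have hh1 : (1 / 2 : ℝ) ≤ 1 := by norm_num
  set Y : (ι → Bool) → T → ℝ := fun ε x => ∑ j, sgn (ε j) * h x j with hY
  set D : ℕ → (ι → Bool) → ℝ := fun k ε => ‖fun x => Y ε (σ (k + 1) x) - Y ε (σ k x)‖ with hDdef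
  have hD0 : ∀ k ε, 0 ≤ D k ε := fun k ε => norm_nonneg _
  have hDk : ∀ k < n, bernoulliExp (1 / 2) (fun ε => D k ε ^ (2 * p))
      ≤ 3 * (2 * Real.exp 1 ^ 2) ^ p * c k ^ (2 * p) := by
    intro k hk
    have := bernoulliExp_half_max_pow_le (Finset.univ.image fun x => (σ k x, σ (k + 1) x))
      (fun l j => h l.2 j - h l.1 j) (hv k hk) (by
        intro l hl
        obtain ⟨x, -, rfl⟩ := Finset.mem_image.1 hl
        exact hvar k hk x) hp (hr k hk) (hcard k hk) (D k) (hD0 k) (by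
        intro ε
        obtain ⟨x, hx⟩ := Finite.exists_max fun x => ‖Y ε (σ (k + 1) x) - Y ε (σ k x)‖
        refine ⟨(σ k x, σ (k + 1) x), Finset.mem_image_of_mem _ (Finset.mem_univ x), ?_⟩
        have h1 : D k ε ≤ ‖Y ε (σ (k + 1) x) - Y ε (σ k x)‖ :=
          (pi_norm_le_iff_of_nonneg (norm_nonneg _)).2 hx
        refine h1.trans (le_of_eq ?_)
        rw [Real.norm_eq_abs, hY, ← Finset.sum_sub_distrib]
        simp only [mul_sub])
    refine this.trans ?_
    rw [pow_mul (c k), mul_assoc _ (r k : ℝ), mul_pow _ ((r k : ℝ) * v k), mul_assoc (3 : ℝ)]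
    have := hrv k hk
    have := (hv k hk).le
    gcongr
  have htel : ∀ ε, ‖Y ε‖ ≤ ∑ k ∈ Finset.range n, D k ε := by
    intro ε
    refine (pi_norm_le_iff_of_nonneg (Finset.sum_nonneg fun k _ => hD0 k ε)).2 fun x => ?_
    have : Y ε x = ∑ k ∈ Finset.range n, (Y ε (σ (k + 1) x) - Y ε (σ k x)) := by
      rw [Finset.sum_range_sub (fun k => Y ε (σ k x)), hσn]
      simp [hY, hσ0]
    rw [this]
    exact (norm_sum_le _ _).trans (Finset.sum_le_sum fun k _ =>
      norm_le_pi_norm (fun x => Y ε (σ (k + 1) x) - Y ε (σ k x)) x)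
  set s := ∑ i ∈ Finset.range n, c i with hs
  have hs0 : 0 < s := Finset.sum_pos (fun k hk => hc k (Finset.mem_range.1 hk))
    (Finset.nonempty_range_iff.2 hn)
  have hpt : ∀ ε, ‖Y ε‖ ^ (2 * p) ≤ s ^ (2 * p) * ∑ k ∈ Finset.range n,
      (c k / s) * (c k ^ (2 * p))⁻¹ * D k ε ^ (2 * p) := by
    intro ε
    refine (pow_le_pow_left₀ (norm_nonneg _) (htel ε) _).trans
      ((sum_pow_le_of_sizes hn c (fun k => D k ε) hc (fun k _ => hD0 k ε) (2 * p)).trans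
        (le_of_eq ?_))
    congr 1
    refine Finset.sum_congr rfl fun k _ => ?_
    rw [div_pow]; ring
  refine (bernoulliExp_mono hh0 hh1 hpt).trans ?_
  rw [bernoulliExp_mul_left, bernoulliExp_sum]
  simp only [bernoulliExp_mul_left]
  rw [mul_comm]
  refine mul_le_mul_of_nonneg_right ?_ (by positivity)
  calc _ ≤ ∑ k ∈ Finset.range n, (c k / s) * (3 * (2 * Real.exp 1 ^ 2) ^ p) := by
        refine Finset.sum_le_sum fun k hk => ?_
        have hk' := Finset.mem_range.1 hk
        have hck := hc k hk'
        rw [mul_assoc]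
        refine mul_le_mul_of_nonneg_left ?_ (by positivity)
        rw [inv_mul_le_iff₀ (by positivity)]
        linarith [hDk k hk']
    _ = _ := by rw [← Finset.sum_mul, ← Finset.sum_div, ← hs, div_self hs0.ne', one_mul]

end Chaining

/-! ### Maurey's empirical method -/

section Maurey

/-- Hoeffding's lemma for a finitely supported law. -/
theorem sum_mul_exp_le_of_mean_zero {V : Type*} [Fintype V] (w : V → ℝ) (hw : ∀ a, 0 ≤ w a)
    (hw1 : ∑ a, w a = 1) (Y : V → ℝ) (hY : ∑ a, w a * Y a = 0) {B : ℝ} (hB : 0 < B)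
    (hYB : ∀ a, |Y a| ≤ B) (s : ℝ) :
    ∑ a, w a * Real.exp (s * Y a) ≤ Real.exp (s ^ 2 * B ^ 2 / 2) := by
  have hpt : ∀ a, Real.exp (s * Y a) ≤ Real.cosh (s * B) + Y a / B * Real.sinh (s * B) := by
    intro a
    have hl : 0 ≤ (1 + Y a / B) / 2 := by
      have := (abs_le.1 (hYB a)).1
      have : -1 ≤ Y a / B := by rw [le_div_iff₀ hB]; linarith
      linarith
    have hu : 0 ≤ (1 - Y a / B) / 2 := by
      have := (abs_le.1 (hYB a)).2
      have : Y a / B ≤ 1 := by rw [div_le_iff₀ hB]; linarith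
      linarith
    have h := convexOn_exp.2 (Set.mem_univ (s * B)) (Set.mem_univ (-(s * B))) hl hu (by ring)
    simp only [smul_eq_mul] at h
    have e : (1 + Y a / B) / 2 * (s * B) + (1 - Y a / B) / 2 * -(s * B) = s * Y a := by
      field_simp; ring
    rw [e] at h
    rw [Real.cosh_eq, Real.sinh_eq]
    linarith
  calc _ ≤ ∑ a, w a * (Real.cosh (s * B) + Y a / B * Real.sinh (s * B)) :=
        Finset.sum_le_sum fun a _ => mul_le_mul_of_nonneg_left (hpt a) (hw a)
    _ = (∑ a, w a) * Real.cosh (s * B) + (∑ a, w a * Y a) * (Real.sinh (s * B) / B) := by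
        rw [Finset.sum_mul, Finset.sum_mul, ← Finset.sum_add_distrib]
        exact Finset.sum_congr rfl fun a _ => by ring
    _ ≤ _ := by
        rw [hw1, hY, one_mul, zero_mul, add_zero]
        refine (Real.cosh_le_exp_half_sq _).trans (le_of_eq ?_)
        rw [mul_pow]

/-- Derandomized sampling: the points are chosen one at a time so that the exponential potential grows
no faster than its mean. -/
theorem exists_word_potential_le {V : Type*} [Fintype V] (w : V → ℝ) (hw : ∀ a, 0 ≤ w a)
    (hw1 : ∑ a, w a = 1) {κ : Type*} [Fintype κ] (Y : κ → V → ℝ)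
    (hY : ∀ t, ∑ a, w a * Y t a = 0) {B : ℝ} (hB : 0 < B) (hYB : ∀ t a, |Y t a| ≤ B) (s : ℝ)
    (M : ℕ) :
    ∃ a : Fin M → V, ∑ t, Real.exp (s * ∑ k, Y t (a k))
      ≤ Fintype.card κ * Real.exp (M * (s ^ 2 * B ^ 2 / 2)) := by
  induction M with
  | zero => exact ⟨Fin.elim0, by simp⟩
  | succ M ih =>
    obtain ⟨a, ha⟩ := ih
    set Q := ∑ t, Real.exp (s * ∑ k, Y t (a k)) with hQ
    -- Otherwise the mean of the new potential would be too large.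
    obtain ⟨b, hb⟩ : ∃ b, ∑ t, Real.exp (s * ∑ k, Y t (a k)) * Real.exp (s * Y t b)
        ≤ Q * Real.exp (s ^ 2 * B ^ 2 / 2) := by
      by_contra! hcon
      have hne : ∃ b, 0 < w b := by
        by_contra! h
        have : ∑ a, w a ≤ 0 := Finset.sum_nonpos fun a _ => h a
        linarith
      obtain ⟨b₀, hb₀⟩ := hne
      have h1 : ∑ b, w b * (Q * Real.exp (s ^ 2 * B ^ 2 / 2))
          < ∑ b, w b * ∑ t, Real.exp (s * ∑ k, Y t (a k)) * Real.exp (s * Y t b) :=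
        Finset.sum_lt_sum (fun b _ => mul_le_mul_of_nonneg_left (hcon b).le (hw b))
          ⟨b₀, Finset.mem_univ _, mul_lt_mul_of_pos_left (hcon b₀) hb₀⟩
      rw [← Finset.sum_mul, hw1, one_mul] at h1
      have h2 : ∑ b, w b * ∑ t, Real.exp (s * ∑ k, Y t (a k)) * Real.exp (s * Y t b)
          = ∑ t, Real.exp (s * ∑ k, Y t (a k)) * ∑ b, w b * Real.exp (s * Y t b) := by
        simp only [Finset.mul_sum]
        rw [Finset.sum_comm]
        exact Finset.sum_congr rfl fun _ _ => Finset.sum_congr rfl fun _ _ => by ring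
      have h3 : ∑ t, Real.exp (s * ∑ k, Y t (a k)) * ∑ b, w b * Real.exp (s * Y t b)
          ≤ Q * Real.exp (s ^ 2 * B ^ 2 / 2) := by
        rw [hQ, Finset.sum_mul]
        exact Finset.sum_le_sum fun t _ => mul_le_mul_of_nonneg_left
          (sum_mul_exp_le_of_mean_zero w hw hw1 (Y t) (hY t) hB (hYB t) s) (Real.exp_pos _).le
      linarith
    refine ⟨Fin.cons b a, ?_⟩
    have e : ∀ t, Real.exp (s * ∑ k, Y t ((Fin.cons b a : Fin (M + 1) → V) k))
        = Real.exp (s * ∑ k, Y t (a k)) * Real.exp (s * Y t b) := by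
      intro t
      rw [Fin.sum_univ_succ, ← Real.exp_add]
      simp only [Fin.cons_zero, Fin.cons_succ]
      ring_nf
    simp only [e]
    calc _ ≤ Q * Real.exp (s ^ 2 * B ^ 2 / 2) := hb
      _ ≤ Fintype.card κ * Real.exp (M * (s ^ 2 * B ^ 2 / 2)) * Real.exp (s ^ 2 * B ^ 2 / 2) := by
          gcongr
      _ = _ := by
          rw [mul_assoc, ← Real.exp_add]; push_cast; ring_nf

/-- The logarithmic size of a set of `k` sampled coordinates: real and imaginary parts and their
signs give `4 k` test functionals, and the additional `1` keeps it positive for `k = 0`. -/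
noncomputable def logSize (k : ℕ) : ℝ := Real.log (4 * (k + 1))

theorem one_le_logSize (k : ℕ) : 1 ≤ logSize k := by
  rw [logSize, Real.le_log_iff_exp_le (by positivity)]
  have := Real.exp_one_lt_d9
  have : (0 : ℝ) ≤ k := Nat.cast_nonneg k
  linarith

/-- Maurey's empirical method in the supremum norm over a set `S` of coordinates. -/
theorem exists_word_norm_sum_sub_le {ι : Type*} [DecidableEq ι] {V : Type*} [Fintype V] (w : V → ℝ)
    (hw : ∀ a, 0 ≤ w a) (hw1 : ∑ a, w a = 1) (g : V → ι → ℂ) (μ : ι → ℂ)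
    (hμ : ∀ j, ∑ a, (w a : ℂ) * g a j = μ j) {B : ℝ} (hB : 0 < B)
    (hgB : ∀ a j, ‖g a j - μ j‖ ≤ B) (S : Finset ι) {M : ℕ} (hM : M ≠ 0) :
    ∃ a : Fin M → V, ∀ j ∈ S,
      ‖∑ k, (g (a k) j - μ j)‖ ≤ 2 * (B * √(2 * M * logSize S.card)) := by
  set l := logSize S.card with hl
  have hl1 : 1 ≤ l := one_le_logSize _
  have hM0 : (0 : ℝ) < M := by exact_mod_cast Nat.pos_of_ne_zero hM
  set part : Bool → ℂ → ℝ := fun d z => if d = true then z.re else z.im with hpart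
  have hpart_le : ∀ d z, |part d z| ≤ ‖z‖ := by
    intro d z
    cases d
    · exact Complex.abs_im_le_norm z
    · exact Complex.abs_re_le_norm z
  have hmean : ∀ d j, ∑ a, w a * part d (g a j - μ j) = 0 := by
    intro d j
    have h0 : ∑ a, (w a : ℂ) * (g a j - μ j) = 0 := by
      simp only [mul_sub, Finset.sum_sub_distrib, hμ, ← Finset.sum_mul]
      rw [← Complex.ofReal_sum, hw1]; simp
    cases d
    · have := congrArg Complex.im h0
      simpa [hpart] using this
    · have := congrArg Complex.re h0
      simpa [hpart] using this
  set s : ℝ := √(2 * l / M) / B with hs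
  have hs0 : 0 < s := div_pos (Real.sqrt_pos.2 (by positivity)) hB
  obtain ⟨a, ha⟩ := exists_word_potential_le w hw hw1
    (fun (t : S × Bool × Bool) b => sgn t.2.1 * part t.2.2 (g b t.1 - μ t.1)) (by
      intro t
      simp only [mul_left_comm _ (sgn _), ← Finset.mul_sum, hmean, mul_zero]) hB (by
      intro t b
      rw [abs_mul, abs_sgn, one_mul]
      exact (hpart_le _ _).trans (hgB _ _)) s M
  refine ⟨a, fun j hj => ?_⟩
  have hsq : s ^ 2 * B ^ 2 = 2 * l / M := by
    rw [hs, div_pow, div_mul_cancel₀ _ (by positivity), Real.sq_sqrt (by positivity)]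
  have hcard : ((Fintype.card (S × Bool × Bool) : ℕ) : ℝ) ≤ Real.exp l := by
    rw [hl, logSize, Real.exp_log (by positivity)]
    simp only [Fintype.card_prod, Fintype.card_coe, Fintype.card_bool]
    push_cast; linarith
  have hexp : M * (s ^ 2 * B ^ 2 / 2) = l := by rw [hsq]; field_simp
  rw [hexp] at ha
  have htest : ∀ e d, sgn e * part d (∑ k, (g (a k) j - μ j)) ≤ B * √(2 * M * l) := by
    intro e d
    have h1 : Real.exp (s * ∑ k, sgn e * part d (g (a k) j - μ j)) ≤ Real.exp (2 * l) := by
      have hle : Real.exp (s * ∑ k, sgn e * part d (g (a k) j - μ j)) ≤ _ :=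
        Finset.single_le_sum (s := Finset.univ) (f := fun t : S × Bool × Bool =>
          Real.exp (s * ∑ k, sgn t.2.1 * part t.2.2 (g (a k) t.1 - μ t.1)))
          (fun t _ => (Real.exp_pos _).le) (Finset.mem_univ ((⟨j, hj⟩ : S), e, d))
      refine hle.trans (ha.trans ?_)
      rw [two_mul, Real.exp_add]
      exact mul_le_mul_of_nonneg_right hcard (Real.exp_pos _).le
    rw [Real.exp_le_exp, ← Finset.mul_sum] at h1
    have h2 : ∑ k, part d (g (a k) j - μ j) = part d (∑ k, (g (a k) j - μ j)) := by
      cases d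
      · simp [hpart]
      · simp [hpart]
    rw [h2, mul_comm, ← le_div_iff₀ hs0] at h1
    refine h1.trans (le_of_eq ?_)
    rw [hs, div_div_eq_mul_div, div_eq_iff (Real.sqrt_pos.2 (by positivity)).ne', mul_assoc B,
      ← Real.sqrt_mul (by positivity)]
    rw [show 2 * M * l * (2 * l / M) = (2 * l) ^ 2 by field_simp,
      Real.sqrt_sq (by positivity)]
    ring
  have habs : ∀ d, |part d (∑ k, (g (a k) j - μ j))| ≤ B * √(2 * M * l) := by
    intro d
    have h1 := htest true d
    have h2 := htest false d
    simp only [sgn, if_true, Bool.false_eq_true, if_false] at h1 h2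
    exact abs_le.2 ⟨by linarith, by linarith⟩
  have h1 := habs true
  have h2 := habs false
  have h3 := Complex.norm_le_abs_re_add_abs_im (∑ k, (g (a k) j - μ j))
  simp only [hpart, if_true, Bool.false_eq_true, if_false] at h1 h2
  linarith

variable {ι κ : Type*} [Fintype ι]

theorem norm_mulVec_le (F : Matrix κ ι ℂ) {β ρ : ℝ} (hβ : 0 ≤ β) (hF : ∀ j i, ‖F j i‖ ≤ β)
    {x : ι → ℂ} (hx : ∑ i, ‖x i‖ ≤ ρ) (j : κ) : ‖F.mulVec x j‖ ≤ β * ρ := by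
  rw [Matrix.mulVec, dotProduct]
  calc _ ≤ ∑ i, β * ‖x i‖ := (norm_sum_le _ _).trans (Finset.sum_le_sum fun i _ => by
        rw [norm_mul]; exact mul_le_mul_of_nonneg_right (hF j i) (norm_nonneg _))
    _ ≤ _ := by rw [← Finset.mul_sum]; gcongr

variable [DecidableEq κ]

/-- Points `x` with `∑ ‖x i‖ ≤ ρ` are convex combinations of `0` and the vectors
`± 2 ρ e_i`, `± 2 ρ √-1 e_i`, hence close to averages of `M` of them. -/
theorem exists_word_norm_mulVec_sub_le (F : Matrix κ ι ℂ) {β ρ : ℝ} (hβ : 0 < β)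
    (hF : ∀ j i, ‖F j i‖ ≤ β) (hρ : 0 < ρ) (S : Finset κ) {M : ℕ} (hM : M ≠ 0) :
    ∃ val : (Fin M → Option (ι × Bool × Bool)) → κ → ℂ, ∀ x : ι → ℂ, ∑ i, ‖x i‖ ≤ ρ →
      ∃ a, ∀ j ∈ S, ‖F.mulVec x j - val a j‖ ≤ 17 / 2 * (ρ * β) * √(logSize S.card / M) := by
  have hM0 : (0 : ℝ) < M := by exact_mod_cast Nat.pos_of_ne_zero hM
  have hl := one_le_logSize S.card
  set g : Option (ι × Bool × Bool) → κ → ℂ := fun o j => o.elim 0 fun t =>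
    (2 * ρ * sgn t.2.2 : ℝ) * (if t.2.1 = true then 1 else Complex.I) * F j t.1 with hg
  have hgn : ∀ o j, ‖g o j‖ ≤ 2 * (ρ * β) := by
    rintro (_ | ⟨i, d, e⟩) j
    · simp only [hg, Option.elim_none, norm_zero]; positivity
    · simp only [hg, Option.elim_some, norm_mul, Complex.norm_real, Real.norm_eq_abs, 
        abs_sgn, mul_one, abs_of_pos hρ, abs_two]
      have : ‖(if d = true then 1 else Complex.I : ℂ)‖ = 1 := by cases d <;> simp
      rw [this, mul_one]
      nlinarith [hF j i]
  refine ⟨fun a j => (M : ℂ)⁻¹ * ∑ k, g (a k) j, fun x hx => ?_⟩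
  set u : ι → Bool → ℝ := fun i d => (if d = true then (x i).re else (x i).im) / (2 * ρ) with hu
  have hu1 : ∑ i, ∑ d, |u i d| ≤ 1 := by
    have : ∀ i, ∑ d, |u i d| ≤ ‖x i‖ / ρ := by
      intro i
      simp only [hu, Fintype.sum_bool, if_true, Bool.false_eq_true, if_false, abs_div]
      rw [abs_of_pos (show (0 : ℝ) < 2 * ρ by positivity), ← add_div, div_le_div_iff₀
        (by positivity) hρ]
      have h1 := Complex.abs_re_le_norm (x i)
      have h2 := Complex.abs_im_le_norm (x i)
      nlinarith
    refine (Finset.sum_le_sum fun i _ => this i).trans ?_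
    rw [← Finset.sum_div, div_le_one hρ]
    exact hx
  set w : Option (ι × Bool × Bool) → ℝ := fun o => o.elim (1 - ∑ i, ∑ d, |u i d|) fun t =>
    max (sgn t.2.2 * u t.1 t.2.1) 0 with hw
  have hmax : ∀ y : ℝ, max y 0 + max (-y) 0 = |y| := by
    intro y
    rcases le_total y 0 with h | h
    · rw [max_eq_right h, max_eq_left (by linarith), abs_of_nonpos h, zero_add]
    · rw [max_eq_left h, max_eq_right (by linarith), abs_of_nonneg h, add_zero]
  have hmax' : ∀ y : ℝ, max y 0 - max (-y) 0 = y := by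
    intro y
    rcases le_total y 0 with h | h
    · rw [max_eq_right h, max_eq_left (by linarith)]; ring
    · rw [max_eq_left h, max_eq_right (by linarith)]; ring
  have hw0 : ∀ o, 0 ≤ w o := by
    rintro (_ | t)
    · simp only [hw, Option.elim_none]; linarith
    · exact le_max_right _ _
  have hw1 : ∑ o, w o = 1 := by
    rw [Fintype.sum_option]
    simp only [hw, Option.elim_none, Option.elim_some, Fintype.sum_prod_type]
    have : ∀ i d, ∑ e, max (sgn e * u i d) 0 = |u i d| := by
      intro i d
      rw [← hmax]; simp [sgn]
    simp only [this]
    ring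
  have hmean : ∀ j, ∑ o, (w o : ℂ) * g o j = F.mulVec x j := by
    intro j
    rw [Fintype.sum_option]
    simp only [hw, hg, Option.elim_none, Option.elim_some, Fintype.sum_prod_type, mul_zero,
      zero_add]
    rw [Matrix.mulVec, dotProduct]
    refine Finset.sum_congr rfl fun i _ => ?_
    have h1 : ∀ d, ∑ e, ((max (sgn e * u i d) 0 : ℝ) : ℂ) * ((2 * ρ * sgn e : ℝ) *
        (if d = true then 1 else Complex.I) * F j i)
        = 2 * ρ * (u i d : ℂ) * (if d = true then 1 else Complex.I) * F j i := by
      intro d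
      have := congrArg (fun r : ℝ => (r : ℂ)) (hmax' (u i d))
      simp only [Complex.ofReal_sub] at this
      simp only [Fintype.sum_bool, sgn, if_true, Bool.false_eq_true, if_false, one_mul, neg_mul]
      push_cast at this ⊢
      linear_combination (2 * ρ * (if d = true then 1 else Complex.I) * F j i) * this
    rw [Finset.sum_congr rfl fun d _ => h1 d]
    simp only [Fintype.sum_bool, if_true, Bool.false_eq_true, if_false, hu]
    have hρ' : (ρ : ℂ) ≠ 0 := by exact_mod_cast hρ.ne'
    push_cast
    have hx' := Complex.re_add_im (x i)
    field_simp
    linear_combination F j i * hx'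
  have hxn : ∀ j, ‖F.mulVec x j‖ ≤ β * ρ := norm_mulVec_le F hβ.le hF hx
  obtain ⟨a, ha⟩ := exists_word_norm_sum_sub_le w hw0 hw1 g (F.mulVec x) hmean
    (B := 3 * (ρ * β)) (by positivity) (fun o j => (norm_sub_le _ _).trans (by
      linarith [hgn o j, hxn j])) S hM
  refine ⟨a, fun j hj => ?_⟩
  have h1 := ha j hj
  have hMC : (M : ℂ) ≠ 0 := by exact_mod_cast hM
  have e : F.mulVec x j - (M : ℂ)⁻¹ * ∑ k, g (a k) j
      = -((M : ℂ)⁻¹ * ∑ k, (g (a k) j - F.mulVec x j)) := by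
    rw [Finset.sum_sub_distrib, Finset.sum_const, Finset.card_univ, Fintype.card_fin, nsmul_eq_mul]
    field_simp
    ring
  rw [e, norm_neg, norm_mul, norm_inv, Complex.norm_natCast, inv_mul_le_iff₀ hM0]
  refine h1.trans ?_
  have e2 : √(2 * M * logSize S.card) = M * (√2 * √(logSize S.card / M)) := by
    rw [← Real.sqrt_mul (by norm_num), Real.sqrt_eq_iff_mul_self_eq (by positivity) (by positivity)]
    rw [mul_mul_mul_comm, Real.mul_self_sqrt (by positivity)]
    field_simp
  rw [e2]
  have h2 : √2 ≤ 17 / 12 := by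
    rw [Real.sqrt_le_left (by norm_num)]; norm_num
  calc _ = M * (6 * (ρ * β) * √(logSize S.card / M)) * √2 := by ring
    _ ≤ M * (6 * (ρ * β) * √(logSize S.card / M)) * (17 / 12) := by gcongr
    _ = _ := by ring

/-- The words of Maurey's method select representatives inside any family of points, at the cost of
doubling the distance. -/
theorem exists_representatives [DecidableEq ι] {T : Type*} [Fintype T]
    [DecidableEq T] (pos : T → ι → ℂ)
    (F : Matrix κ ι ℂ) {β ρ : ℝ} (hβ : 0 < β)
    (hF : ∀ j i, ‖F j i‖ ≤ β) (hρ : 0 < ρ) (hpos : ∀ x, ∑ i, ‖pos x i‖ ≤ ρ) (S : Finset κ) {M : ℕ}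
    (hM : M ≠ 0) :
    ∃ σ : T → T, (Finset.univ.image σ).card ≤ (4 * Fintype.card ι + 1) ^ M ∧
      ∀ x, ∀ j ∈ S, ‖F.mulVec (pos x) j - F.mulVec (pos (σ x)) j‖
        ≤ 17 * (ρ * β) * √(logSize S.card / M) := by
  obtain ⟨val, hval⟩ := exists_word_norm_mulVec_sub_le F hβ hF hρ S hM
  choose a ha using fun x => hval (pos x) (hpos x)
  -- `rep` picks one point for each word in use.
  have hrep : ∃ rep : (Fin M → Option (ι × Bool × Bool)) → Option T, ∀ x, ∃ y,
      rep (a x) = some y ∧ a y = a x := by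
    classical
    refine ⟨fun b => if h : ∃ y, a y = b then some h.choose else none, fun x => ?_⟩
    have h : ∃ y, a y = a x := ⟨x, rfl⟩
    exact ⟨h.choose, by simp only [dif_pos h], h.choose_spec⟩
  obtain ⟨rep, hrep⟩ := hrep
  choose σ hσ1 hσ2 using hrep
  refine ⟨σ, ?_, fun x j hj => ?_⟩
  · have h1 : ((Finset.univ.image σ).image some) ⊆ Finset.univ.image rep := by
      intro o ho
      simp only [Finset.mem_image, Finset.mem_univ, true_and] at ho ⊢
      obtain ⟨y, ⟨x, rfl⟩, rfl⟩ := ho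
      exact ⟨a x, hσ1 x⟩
    have h2 := (Finset.card_le_card h1).trans Finset.card_image_le
    rw [Finset.card_image_of_injective _ (Option.some_injective T)] at h2
    refine h2.trans (le_of_eq ?_)
    simp [Fintype.card_option, Fintype.card_prod, mul_comm]
  · have h1 := ha x j hj
    have h2 := ha (σ x) j hj
    rw [hσ2 x] at h2
    rw [← sub_sub_sub_cancel_right _ _ (val (a x) j)]
    refine (norm_sub_le _ _).trans ?_
    linarith

end Maurey

/-! ### The quadratic process on a fixed sample -/

section FixedSample

variable {ι κ : Type*} [Fintype ι] [Fintype κ]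

/-- The number of coordinates selected by a pattern. -/
def sampleSize (ω : κ → Bool) : ℕ := (Finset.univ.filter fun j => ω j = true).card

/-- Variance of the difference of two quadratic processes: one factor of the difference of squares is
small uniformly on the sample, the other one is controlled by the energies on the sample. -/
theorem sum_indic_sq_sub_sq_le (ω : κ → Bool) (y z : κ → ℂ) {d W : ℝ}
    (hyz : ∀ j, ω j = true → ‖y j - z j‖ ≤ d) (hy : ∑ j, indic (ω j) * ‖y j‖ ^ 2 ≤ W)
    (hz : ∑ j, indic (ω j) * ‖z j‖ ^ 2 ≤ W) :
    ∑ j, (indic (ω j) * ‖y j‖ ^ 2 - indic (ω j) * ‖z j‖ ^ 2) ^ 2 ≤ 4 * d ^ 2 * W := by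
  have hpt : ∀ j, (indic (ω j) * ‖y j‖ ^ 2 - indic (ω j) * ‖z j‖ ^ 2) ^ 2
      ≤ 2 * d ^ 2 * (indic (ω j) * ‖y j‖ ^ 2 + indic (ω j) * ‖z j‖ ^ 2) := by
    intro j
    by_cases h : ω j = true
    · simp only [h, indic, if_true, one_mul]
      have h1 := (abs_norm_sub_norm_le (y j) (z j)).trans (hyz j h)
      have h2 : (‖y j‖ - ‖z j‖) ^ 2 ≤ d ^ 2 := by
        rw [← sq_abs]; exact pow_le_pow_left₀ (abs_nonneg _) h1 2
      have h3 : (‖y j‖ + ‖z j‖) ^ 2 ≤ 2 * (‖y j‖ ^ 2 + ‖z j‖ ^ 2) := by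
        nlinarith [sq_nonneg (‖y j‖ - ‖z j‖)]
      calc _ = (‖y j‖ - ‖z j‖) ^ 2 * (‖y j‖ + ‖z j‖) ^ 2 := by ring
        _ ≤ d ^ 2 * (2 * (‖y j‖ ^ 2 + ‖z j‖ ^ 2)) :=
          mul_le_mul h2 h3 (sq_nonneg _) (sq_nonneg _)
        _ = _ := by ring
    · simp [h, indic]
  refine (Finset.sum_le_sum fun j _ => hpt j).trans ?_
  rw [← Finset.mul_sum, Finset.sum_add_distrib]
  nlinarith [sq_nonneg d]

/-- The geometric and the constant parts of the sizes of the links, summed over all levels. -/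
theorem sum_link_sizes_sq_le (K : ℕ) {a u v : ℝ} (ha : 0 ≤ a) (hu : 0 ≤ u) (hv : 0 ≤ v) :
    (∑ k ∈ Finset.range (K + 1), √a * ((1 / 2) ^ k * √u + √v)) ^ 2
      ≤ a * (8 * u + 2 * ((K + 1) ^ 2 * v)) := by
  have h1 : ∑ k ∈ Finset.range (K + 1), √a * ((1 / 2) ^ k * √u + √v)
      ≤ √a * (2 * √u + (K + 1) * √v) := by
    rw [← Finset.mul_sum, Finset.sum_add_distrib, ← Finset.sum_mul, Finset.sum_const,
      Finset.card_range, nsmul_eq_mul]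
    have := sum_geometric_two_le (K + 1)
    push_cast
    gcongr
  have h2 := Real.sq_sqrt ha
  have h3 := Real.sq_sqrt hu
  have h4 := Real.sq_sqrt hv
  calc _ ≤ (√a * (2 * √u + (K + 1) * √v)) ^ 2 := by gcongr
    _ = √a ^ 2 * (2 * √u + (K + 1) * √v) ^ 2 := by ring
    _ ≤ √a ^ 2 * (8 * √u ^ 2 + 2 * ((K + 1) ^ 2 * √v ^ 2)) := by
        gcongr
        nlinarith [sq_nonneg (2 * √u - (K + 1) * √v)]
    _ = _ := by rw [h2, h3, h4]

/-- The absolute constant of the chaining bound; it is at least `14.8 * 136 ^ 2 * 84`, where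
`14.8 ≥ 2 e ^ 2` comes from the moments of maxima, `136 = 4 * 34` from the scales of the approximations
and `84 = 2 * 42` from the logarithms of the numbers of links. -/
def momentConst : ℝ := 23000000

/-- Chaining for the quadratic process conditionally on the sample `ω`. Down to the scale
`2 ^ (-K) ≤ ξ ^ (-1/2)` the approximations come from Maurey's method; the last link, at that scale, is
estimated by the number of points of `T` alone. -/
theorem bernoulliExp_half_quadratic_process_le [DecidableEq ι] [DecidableEq κ] {T : Type*} [Fintype T]
    [DecidableEq T] (pos : T → ι → ℂ)
    (o : T) (ho : pos o = 0) (F : Matrix κ ι ℂ) {β : ℝ} (hβ : 0 < β) (hF : ∀ j i, ‖F j i‖ ≤ β)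
    {ξ K : ℕ} (hξ : ξ ≠ 0) (hK : ξ ≤ 4 ^ K) (hpos : ∀ x, ∑ i, ‖pos x i‖ ≤ 2 * √ξ)
    (hn : 2 ≤ Fintype.card ι)
    (hT : (Fintype.card T : ℝ) ≤ Real.exp (21 * ξ * Real.log (Fintype.card ι)))
    (ω : κ → Bool) {W : ℝ} (hW : 0 < W)
    (hωW : ∀ x, ∑ j, indic (ω j) * ‖F.mulVec (pos x) j‖ ^ 2 ≤ W) {p : ℕ} (hp : p ≠ 0) :
    bernoulliExp (1 / 2) (fun ε =>
        ‖fun x => ∑ j, sgn (ε j) * (indic (ω j) * ‖F.mulVec (pos x) j‖ ^ 2)‖ ^ (2 * p))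
      ≤ 3 * (momentConst * (ξ * β ^ 2) * W *
        (p + (K + 1) ^ 2 * (logSize (sampleSize ω) * Real.log (Fintype.card ι)))) ^ p := by
  have : Nonempty T := ⟨o⟩
  set S := Finset.univ.filter fun j => ω j = true with hS
  set l := logSize (sampleSize ω) with hl
  have hl1 : 1 ≤ l := one_le_logSize _
  have hn2 : (2 : ℝ) ≤ Fintype.card ι := by exact_mod_cast hn
  set n : ℝ := (Fintype.card ι : ℝ) with hndef
  set y := Real.log n with hy
  have hy1 : 1 / 2 ≤ y := by
    have := Real.log_le_log (by norm_num) hn2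
    linarith [Real.log_two_gt_d9]
  have hξ0 : (0 : ℝ) < ξ := by exact_mod_cast Nat.pos_of_ne_zero hξ
  set b : ℝ := ξ * β ^ 2 with hb
  have hb0 : 0 < b := by positivity
  have hsb : √ξ * β = √b := by
    rw [hb, Real.sqrt_mul hξ0.le, Real.sqrt_sq hβ.le]
  set M : ℕ → ℕ := fun k => ⌈4 ^ k * l⌉₊ with hM
  have hMlow : ∀ k, 4 ^ k * l ≤ M k := fun k => Nat.le_ceil _
  have h4l : ∀ k : ℕ, 1 ≤ 4 ^ k * l := fun k =>
    one_le_mul_of_one_le_of_one_le (one_le_pow₀ (by norm_num)) hl1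
  have hMup : ∀ k, (M k : ℝ) ≤ 2 * (4 ^ k * l) := fun k => by
    have := Nat.ceil_lt_add_one (show 0 ≤ 4 ^ k * l by linarith [h4l k])
    linarith [h4l k]
  have hM0 : ∀ k, M k ≠ 0 := fun k h => by
    have h1 := hMlow k
    have h2 := h4l k
    rw [h, Nat.cast_zero] at h1
    linarith
  choose τ hτcard hτ using fun k => exists_representatives pos F hβ hF
    (show 0 < 2 * √ξ by positivity) hpos S (hM0 k)
  set d : ℕ → ℝ := fun k => 34 * √b * (1 / 2) ^ k with hd
  set σ : ℕ → T → T := fun k => if k = 0 then fun _ => o else if k ≤ K then τ k else id with hσ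
  have hdist : ∀ k x j, ω j = true → ‖F.mulVec (pos x) j - F.mulVec (pos (σ k x)) j‖ ≤ d k := by
    intro k x j hj
    by_cases hk0 : k = 0
    · simp only [hσ, hk0, if_true, ho, Matrix.mulVec_zero, Pi.zero_apply, sub_zero, hd, pow_zero,
        mul_one]
      refine (norm_mulVec_le F hβ.le hF (hpos x) j).trans ?_
      rw [mul_left_comm, mul_comm β, hsb]
      linarith [Real.sqrt_nonneg b]
    · by_cases hkK : k ≤ K
      · simp only [hσ, hk0, if_false, hkK, if_true]
        refine (hτ k x j (by simp [hS, hj])).trans ?_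
        have h1 : √(logSize S.card / M k) ≤ (1 / 2) ^ k := by
          have hMk : (0 : ℝ) < M k := by exact_mod_cast Nat.pos_of_ne_zero (hM0 k)
          rw [Real.sqrt_le_left (by positivity), div_le_iff₀ hMk, ← pow_mul, mul_comm k, pow_mul]
          have h2 : (((1 : ℝ) / 2) ^ 2) ^ k * 4 ^ k = 1 := by
            rw [← mul_pow]; norm_num
          calc logSize S.card = (((1 : ℝ) / 2) ^ 2) ^ k * 4 ^ k * l := by rw [h2, one_mul]; rfl
            _ ≤ _ := by
                rw [mul_assoc]; gcongr; exact hMlow k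
        calc _ ≤ 17 * (2 * √ξ * β) * (1 / 2) ^ k := by gcongr
          _ = _ := by rw [mul_assoc 2, hsb]; ring
      · simp only [hσ, hk0, if_false, hkK, id, sub_self, norm_zero, hd]
        positivity
  have hcardσ : ∀ k ≤ K, (Finset.univ.image (σ k)).card ≤ (4 * Fintype.card ι + 1) ^ M k := by
    intro k hk
    by_cases hk0 : k = 0
    · have : Finset.univ.image (σ k) = {o} := by
        simp only [hσ, hk0, if_true]
        exact Finset.image_const Finset.univ_nonempty o
      rw [this, Finset.card_singleton]
      exact Nat.one_le_pow _ _ (by omega)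
    · simp only [hσ, hk0, if_false, hk, if_true]
      exact hτcard k
  have hbase : ((4 * Fintype.card ι + 1 : ℕ) : ℝ) ≤ Real.exp (4 * y) := by
    have e : Real.exp (4 * y) = n ^ 4 := by
      rw [hy, show (4 : ℝ) = ((4 : ℕ) : ℝ) by norm_num, Real.exp_nat_mul,
        Real.exp_log (by linarith)]
    rw [e]
    push_cast
    have h8 : (2 : ℝ) ^ 3 ≤ n ^ 3 := by gcongr
    nlinarith
  set r : ℕ → ℕ := fun k => p + ⌈40 * (4 ^ k * l * y)⌉₊ with hr
  have hp0 : (0 : ℝ) < p := by exact_mod_cast Nat.pos_of_ne_zero hp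
  have hrup : ∀ k, (r k : ℝ) ≤ p + 42 * (4 ^ k * (l * y)) := by
    intro k
    have h0 : 0 ≤ 40 * (4 ^ k * l * y) := by
      have := h4l k
      positivity
    have h1 := Nat.ceil_lt_add_one h0
    have h2 := h4l k
    simp only [hr]
    push_cast
    nlinarith
  set v : ℕ → ℝ := fun k => 16 * d k ^ 2 * W with hv
  have hdv : ∀ k, v k = 18496 * b * W * (1 / 4) ^ k := by
    intro k
    simp only [hv, hd, mul_pow, Real.sq_sqrt hb0.le]
    rw [← pow_mul, mul_comm k, pow_mul]
    norm_num
    ring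
  have hchain := bernoulliExp_half_chaining
    (fun x j => indic (ω j) * ‖F.mulVec (pos x) j‖ ^ 2) (n := K + 1) (by omega) σ
    (fun x => by funext j; simp [hσ, ho]) (fun x => by simp [hσ]) hp r v
    (fun k => √(18496 * b * W) * ((1 / 2) ^ k * √p + √(42 * (l * y))))
    (fun k _ => by simp [hr]) (fun k _ => by rw [hdv]; positivity) (fun k _ => by positivity) (by
      intro k _
      rw [mul_pow, Real.sq_sqrt (by positivity), hdv]
      have h1 : p * (1 / 4) ^ k + 42 * (l * y) ≤ ((1 / 2) ^ k * √p + √(42 * (l * y))) ^ 2 := by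
        have e1 := Real.sq_sqrt hp0.le
        have e2 := Real.sq_sqrt (show 0 ≤ 42 * (l * y) by positivity)
        have e3 : ((1 / 2 : ℝ) ^ k * √p) ^ 2 = p * (1 / 4) ^ k := by
          rw [mul_pow, e1, ← pow_mul, mul_comm k, pow_mul]; norm_num [mul_comm]
        have e4 : 0 ≤ (1 / 2 : ℝ) ^ k * √p * √(42 * (l * y)) := by positivity
        nlinarith
      have e : (4 : ℝ) ^ k * (1 / 4) ^ k = 1 := by rw [← mul_pow]; norm_num
      calc (r k : ℝ) * (18496 * b * W * (1 / 4) ^ k)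
          ≤ (p + 42 * (4 ^ k * (l * y))) * (18496 * b * W * (1 / 4) ^ k) := by
            gcongr; exact hrup k
        _ = 18496 * b * W * (p * (1 / 4) ^ k + 42 * (4 ^ k * (1 / 4) ^ k * (l * y))) := by ring
        _ = 18496 * b * W * (p * (1 / 4) ^ k + 42 * (l * y)) := by rw [e, one_mul]
        _ ≤ _ := by gcongr) (by
      intro k _ x
      have h := sum_indic_sq_sub_sq_le ω (F.mulVec (pos (σ (k + 1) x))) (F.mulVec (pos (σ k x)))
        (d := 2 * d k) (by
          intro j hj
          rw [← sub_sub_sub_cancel_left _ _ (F.mulVec (pos x) j)]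
          refine (norm_sub_le _ _).trans ?_
          have h1 := hdist k x j hj
          have h2 := hdist (k + 1) x j hj
          have h3 : d (k + 1) ≤ d k := by
            simp only [hd]
            gcongr 34 * √b * ?_
            exact pow_le_pow_of_le_one (by norm_num) (by norm_num) (Nat.le_succ k)
          linarith) (hωW _) (hωW _)
      refine h.trans (le_of_eq ?_)
      simp only [hv]; ring) (by
      intro k hk
      have hrlow : 40 * (4 ^ k * l * y) ≤ (r k : ℝ) := by
        have := Nat.le_ceil (40 * (4 ^ k * l * y))
        simp only [hr]
        push_cast
        linarith
      refine le_trans ?_ (Real.exp_le_exp.2 hrlow)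
      by_cases hkK : k = K
      · have h1 : ((Finset.univ.image fun x => (σ k x, σ (k + 1) x)).card : ℝ)
            ≤ Fintype.card T := by
          exact_mod_cast Finset.card_image_le
        refine h1.trans (hT.trans (Real.exp_le_exp.2 ?_))
        have h2 : (ξ : ℝ) ≤ 4 ^ k := by rw [hkK]; exact_mod_cast hK
        have h3 : (ξ : ℝ) * 1 ≤ 4 ^ k * l := mul_le_mul h2 hl1 zero_le_one (by positivity)
        nlinarith
      · have h1 : (Finset.univ.image fun x => (σ k x, σ (k + 1) x)).card
            ≤ (4 * Fintype.card ι + 1) ^ (M k + M (k + 1)) := by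
          have hsub : (Finset.univ.image fun x => (σ k x, σ (k + 1) x))
              ⊆ (Finset.univ.image (σ k)) ×ˢ (Finset.univ.image (σ (k + 1))) := by
            intro z hz
            obtain ⟨x, -, rfl⟩ := Finset.mem_image.1 hz
            exact Finset.mk_mem_product (Finset.mem_image_of_mem _ (Finset.mem_univ x))
              (Finset.mem_image_of_mem _ (Finset.mem_univ x))
          refine (Finset.card_le_card hsub).trans ?_
          rw [Finset.card_product, pow_add]
          exact Nat.mul_le_mul (hcardσ k (by omega)) (hcardσ (k + 1) (by omega))
        have h2 : ((Finset.univ.image fun x => (σ k x, σ (k + 1) x)).card : ℝ)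
            ≤ ((4 * Fintype.card ι + 1 : ℕ) : ℝ) ^ (M k + M (k + 1)) := by exact_mod_cast h1
        refine h2.trans ((pow_le_pow_left₀ (by positivity) hbase _).trans ?_)
        rw [← Real.exp_nat_mul, Real.exp_le_exp]
        have h3 := hMup k
        have h4 := hMup (k + 1)
        rw [pow_succ] at h4
        push_cast
        nlinarith)
  refine hchain.trans ?_
  rw [pow_mul (∑ k ∈ Finset.range (K + 1), _), mul_assoc, ← mul_pow]
  have hs := sum_link_sizes_sq_le K (show 0 ≤ 18496 * b * W by positivity) hp0.le
    (show 0 ≤ 42 * (l * y) by positivity)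
  have he : 2 * Real.exp 1 ^ 2 ≤ 14.8 := by
    have := Real.exp_one_lt_d9
    have := Real.exp_pos 1
    nlinarith
  gcongr 3 * ?_ ^ p
  calc _ ≤ 14.8 * (18496 * b * W * (8 * p + 2 * ((K + 1) ^ 2 * (42 * (l * y))))) := by
        gcongr
    _ = 18496 * 14.8 * b * W * (8 * p + 84 * ((K + 1) ^ 2 * (l * y))) := by ring
    _ ≤ 18496 * 14.8 * b * W * (84 * (p + (K + 1) ^ 2 * (l * y))) := by
        gcongr; linarith
    _ = (18496 * 14.8 * 84) * (b * W * (p + (K + 1) ^ 2 * (l * y))) := by ring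
    _ ≤ momentConst * (b * W * (p + (K + 1) ^ 2 * (l * y))) := by
        gcongr; norm_num [momentConst]
    _ = _ := by ring

end FixedSample

/-! ### Moments and tails of the centred quadratic process -/

section Moments

variable {ι κ : Type*} [Fintype ι] [Fintype κ]

theorem bernoulliExp_exp_sampleSize_le [DecidableEq κ] {q : ℝ} (h0 : 0 ≤ q) (h1 : q ≤ 1) (s : ℝ) :
    bernoulliExp (ι := κ) q (fun ω => Real.exp (s * sampleSize ω)) ≤
      Real.exp (q * Fintype.card κ * (Real.exp s - 1)) := by
  have h := bernoulliExp_prod q (fun (_ : κ) b => Real.exp (s * indic b))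
  have hsz : ∀ ω : κ → Bool, ∑ j, indic (ω j) = sampleSize ω := by
    intro ω
    simp [indic, sampleSize]
  simp only [← Real.exp_sum, ← Finset.mul_sum, hsz] at h
  rw [h]
  simp only [indic, if_true, Bool.false_eq_true, if_false, mul_one, mul_zero, Real.exp_zero,
    Finset.prod_const, Finset.card_univ]
  have h2 : q * Real.exp s + (1 - q) ≤ Real.exp (q * (Real.exp s - 1)) := by
    have := Real.add_one_le_exp (q * (Real.exp s - 1))
    linarith
  rw [mul_right_comm, mul_comm _ (Fintype.card κ : ℝ), Real.exp_nat_mul]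
  exact pow_le_pow_left₀ (add_nonneg (mul_nonneg h0 (Real.exp_pos s).le) (by linarith)) h2 _

/-- The logarithm of the sample size is comparable to `log m`, up to a factor with bounded moments. -/
theorem logSize_le {m : ℝ} (hm : 2 ≤ m) (k : ℕ) :
    logSize k ≤ 7 * Real.log m * Real.exp (k / m) := by
  have hm0 : 0 < m := by linarith
  have hk : (0 : ℝ) ≤ k := Nat.cast_nonneg k
  have hlog : 0.69 ≤ Real.log m := by
    have := Real.log_le_log (by norm_num) hm
    linarith [Real.log_two_gt_d9]
  have h1 : logSize k = Real.log m + Real.log (4 * (k + 1) / m) := by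
    rw [← Real.log_mul hm0.ne' (by positivity), mul_div_cancel₀ _ hm0.ne', logSize]
  have h2 := Real.log_le_sub_one_of_pos (show 0 < 4 * ((k : ℝ) + 1) / m by positivity)
  have h3 : 4 * ((k : ℝ) + 1) / m ≤ 4 * (k / m) + 2 := by
    have : 4 / m ≤ 2 := by rw [div_le_iff₀ hm0]; linarith
    calc _ = 4 * (k / m) + 4 / m := by ring
      _ ≤ _ := by linarith
  have h4 := Real.add_one_le_exp (k / m)
  have h5 : 0 ≤ k / m := by positivity
  calc logSize k ≤ Real.log m + 4 * (k / m) + 1 := by linarith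
    _ ≤ 7 * Real.log m * (k / m + 1) := by nlinarith
    _ ≤ _ := by gcongr

/-- A self-bounding inequality for a moment `X`. -/
theorem le_pow_of_sq_le {X g : ℝ} (hg0 : 0 ≤ g) (hg : g ≤ 1 / 2) {p : ℕ} (hp : p ≠ 0)
    (h : X ^ 2 ≤ g ^ (2 * p) * (X + 16 ^ p)) : X ≤ (6 * g) ^ p := by
  have hgp : g ^ (2 * p) ≤ 1 / 4 := by
    rw [pow_mul]
    calc (g ^ 2) ^ p ≤ (g ^ 2) ^ 1 :=
          pow_le_pow_of_le_one (by positivity) (by nlinarith) (Nat.one_le_iff_ne_zero.2 hp)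
      _ ≤ 1 / 4 := by nlinarith
  have h16 : (1 : ℝ) ≤ 16 ^ p := one_le_pow₀ (by norm_num)
  have hX : X ≤ 16 ^ p := by
    by_contra! hcon
    nlinarith [pow_nonneg hg0 (2 * p)]
  refine abs_le_of_sq_le_sq' ?_ (by positivity) |>.2
  have h2 : (2 : ℝ) ≤ 2 ^ p := by
    calc (2 : ℝ) = 2 ^ 1 := by norm_num
      _ ≤ 2 ^ p := pow_le_pow_right₀ (by norm_num) (Nat.one_le_iff_ne_zero.2 hp)
  calc X ^ 2 ≤ g ^ (2 * p) * (X + 16 ^ p) := h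
    _ ≤ g ^ (2 * p) * (2 * 16 ^ p) := by gcongr; linarith
    _ ≤ g ^ (2 * p) * (2 ^ p * 16 ^ p) := by gcongr
    _ = (g ^ 2 * 32) ^ p := by rw [pow_mul, mul_pow, ← mul_pow 2]; norm_num
    _ ≤ ((6 * g) ^ 2) ^ p := by gcongr; nlinarith [sq_nonneg g]
    _ = _ := pow_right_comm _ _ _

/-- Moments of the supremum `Z` of the centred quadratic process. The chaining bound involves the energy
on the sample, which is at most `Z + 4`, so that it is an inequality for the moments of `Z` in terms of
themselves. -/
theorem bernoulliExp_quadratic_process_le [DecidableEq ι] [DecidableEq κ] {T : Type*} [Fintype T]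
    [DecidableEq T] (pos : T → ι → ℂ)
    (o : T) (ho : pos o = 0) (F : Matrix κ ι ℂ) {β : ℝ} (hβ : 0 < β) (hF : ∀ j i, ‖F j i‖ ≤ β)
    {ξ K : ℕ} (hξ : ξ ≠ 0) (hK : ξ ≤ 4 ^ K) (hpos : ∀ x, ∑ i, ‖pos x i‖ ≤ 2 * √ξ)
    (hn : 2 ≤ Fintype.card ι)
    (hT : (Fintype.card T : ℝ) ≤ Real.exp (21 * ξ * Real.log (Fintype.card ι)))
    {q m : ℝ} (h0 : 0 ≤ q) (h1 : q ≤ 1) (hqm : q * Fintype.card κ = m) (hm : 2 ≤ m)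
    (hE : ∀ x, q * ∑ j, ‖F.mulVec (pos x) j‖ ^ 2 ≤ 4) {p : ℕ} (hp : p ≠ 0) (hpm : 2 * p ≤ m)
    (hsmall : 180 * momentConst * ((ξ * β ^ 2) *
      (p + (K + 1) ^ 2 * (7 * Real.log m * Real.log (Fintype.card ι)))) ≤ 1 / 2) :
    bernoulliExp q (fun ω =>
        ‖fun x => ∑ j, (indic (ω j) - q) * ‖F.mulVec (pos x) j‖ ^ 2‖ ^ (2 * p))
      ≤ (6 * (180 * momentConst * ((ξ * β ^ 2) *
      (p + (K + 1) ^ 2 * (7 * Real.log m * Real.log (Fintype.card ι)))))) ^ p := by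
  set Z : (κ → Bool) → ℝ := fun ω =>
    ‖fun x => ∑ j, (indic (ω j) - q) * ‖F.mulVec (pos x) j‖ ^ 2‖ with hZ
  set y := Real.log (Fintype.card ι) with hy
  set b : ℝ := ξ * β ^ 2 with hb
  set G : ℝ := p + (K + 1) ^ 2 * (7 * Real.log m * y) with hG
  set X := bernoulliExp q (fun ω => Z ω ^ (2 * p)) with hX
  have hm0 : 0 < m := by linarith
  have hn2 : (2 : ℝ) ≤ Fintype.card ι := by exact_mod_cast hn
  have hy0 : 0 ≤ y := Real.log_nonneg (by linarith)
  have hlm0 : 0 ≤ Real.log m := Real.log_nonneg (by linarith)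
  have hb0 : 0 ≤ b := by positivity
  have hG0 : 0 ≤ G := by positivity
  have hZ0 : ∀ ω, 0 ≤ Z ω := fun ω => norm_nonneg _
  have hW : ∀ ω x, ∑ j, indic (ω j) * ‖F.mulVec (pos x) j‖ ^ 2 ≤ Z ω + 4 := by
    intro ω x
    have e1 : ∑ j, (indic (ω j) - q) * ‖F.mulVec (pos x) j‖ ^ 2 ≤ Z ω :=
      (le_abs_self _).trans (norm_le_pi_norm
        (fun x => ∑ j, (indic (ω j) - q) * ‖F.mulVec (pos x) j‖ ^ 2) x)
    simp only [sub_mul, Finset.sum_sub_distrib, ← Finset.mul_sum] at e1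
    linarith [hE x]
  set C : ℝ := momentConst with hC
  have hC0 : 0 ≤ C := by norm_num [hC, momentConst]
  have hA : ∀ ω : κ → Bool, p + (K + 1) ^ 2 * (logSize (sampleSize ω) * y)
      ≤ G * Real.exp (sampleSize ω / m) := by
    intro ω
    have e1 := logSize_le hm (sampleSize ω)
    have e2 : 1 ≤ Real.exp (sampleSize ω / m) := Real.one_le_exp (by positivity)
    calc _ ≤ p * Real.exp (sampleSize ω / m)
          + (K + 1) ^ 2 * (7 * Real.log m * Real.exp (sampleSize ω / m) * y) := by
          gcongr
          exact le_mul_of_one_le_right (by positivity) e2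
      _ = _ := by rw [hG]; ring
  have hchain : ∀ ω : κ → Bool, bernoulliExp (1 / 2) (fun ε =>
        ‖∑ j, (sgn (ε j) * indic (ω j)) • (fun x => ‖F.mulVec (pos x) j‖ ^ 2)‖ ^ (2 * p))
      ≤ 3 * (C * b * G) ^ p * ((Z ω + 4) ^ p * Real.exp (sampleSize ω / m) ^ p) := by
    intro ω
    have h := bernoulliExp_half_quadratic_process_le pos o ho F hβ hF hξ hK hpos hn hT ω
      (show 0 < Z ω + 4 by linarith [hZ0 ω]) (hW ω) hp
    have e : ∀ ε : κ → Bool, (∑ j, (sgn (ε j) * indic (ω j)) •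
        (fun x => ‖F.mulVec (pos x) j‖ ^ 2) : T → ℝ)
        = fun x => ∑ j, sgn (ε j) * (indic (ω j) * ‖F.mulVec (pos x) j‖ ^ 2) := by
      intro ε
      funext x
      simp only [Finset.sum_apply, Pi.smul_apply, smul_eq_mul, mul_assoc]
    simp only [e]
    refine h.trans ?_
    rw [mul_assoc 3, ← mul_pow, ← mul_pow]
    have hl : 0 ≤ logSize (sampleSize ω) := zero_le_one.trans (one_le_logSize _)
    have hZω := hZ0 ω
    have hbase : 0 ≤ C * b * (Z ω + 4) * (p + (K + 1) ^ 2 * (logSize (sampleSize ω) * y)) := by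
      positivity
    refine mul_le_mul_of_nonneg_left (pow_le_pow_left₀ hbase ?_ p) (by norm_num)
    calc _ ≤ C * b * (Z ω + 4) * (G * Real.exp (sampleSize ω / m)) := by
          gcongr; exact hA ω
      _ = _ := by ring
  have hsym : X ≤ 2 ^ (2 * p) * (3 * (C * b * G) ^ p *
      bernoulliExp q (fun ω => (Z ω + 4) ^ p * Real.exp (sampleSize ω / m) ^ p)) := by
    have h := bernoulliExp_symmetrization h0 h1
      (fun j => (fun x => ‖F.mulVec (pos x) j‖ ^ 2 : T → ℝ)) (p := 2 * p) (by omega)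
    have e : ∀ ω : κ → Bool, ‖(∑ j, (indic (ω j) - q) •
        (fun x => ‖F.mulVec (pos x) j‖ ^ 2) : T → ℝ)‖ = Z ω := by
      intro ω
      simp only [hZ]
      congr 1
      funext x
      simp only [Finset.sum_apply, Pi.smul_apply, smul_eq_mul]
    simp only [e] at h
    refine h.trans (mul_le_mul_of_nonneg_left ?_ (by positivity))
    rw [← bernoulliExp_mul_left]
    exact bernoulliExp_mono h0 h1 hchain
  have hCS := bernoulliExp_cauchySchwarz h0 h1 (fun ω : κ → Bool => (Z ω + 4) ^ p)
    (fun ω => Real.exp (sampleSize ω / m) ^ p)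
  have hexp : bernoulliExp q (fun ω : κ → Bool => (Real.exp (sampleSize ω / m) ^ p) ^ 2)
      ≤ 55 ^ p := by
    have e : ∀ ω : κ → Bool, (Real.exp (sampleSize ω / m) ^ p) ^ 2
        = Real.exp (2 * p / m * sampleSize ω) := by
      intro ω
      rw [← pow_mul, ← Real.exp_nat_mul]
      push_cast
      congr 1
      ring
    simp only [e]
    refine (bernoulliExp_exp_sampleSize_le h0 h1 _).trans ?_
    rw [hqm]
    set u : ℝ := 2 * p / m with hu
    have hu0 : 0 ≤ u := by positivity
    have hu1 : u ≤ 1 := (div_le_one hm0).2 hpm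
    have e1 : Real.exp u - 1 ≤ 2 * u := by
      have := Real.abs_exp_sub_one_le (x := u) (by rwa [abs_of_nonneg hu0])
      rw [abs_of_nonneg hu0] at this
      exact (le_abs_self _).trans this
    have e2 : m * (2 * u) = p * 4 := by rw [hu]; field_simp; ring
    have e3 : Real.exp 4 ≤ 55 := by
      have h4 : Real.exp 4 = Real.exp 1 ^ 4 := by
        rw [← Real.exp_nat_mul]; norm_num
      rw [h4]
      calc Real.exp 1 ^ 4 ≤ 2.7182818286 ^ 4 := by
            gcongr; exact Real.exp_one_lt_d9.le
        _ ≤ 55 := by norm_num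
    calc _ ≤ Real.exp (m * (2 * u)) := by gcongr
      _ = Real.exp 4 ^ p := by rw [e2, Real.exp_nat_mul]
      _ ≤ _ := by gcongr
  have hZ4 : bernoulliExp q (fun ω : κ → Bool => ((Z ω + 4) ^ p) ^ 2)
      ≤ 4 ^ p * (X + 16 ^ p) := by
    have e : ∀ ω, ((Z ω + 4) ^ p) ^ 2 ≤ 4 ^ p * (Z ω ^ (2 * p) + 16 ^ p) := by
      intro ω
      rw [← pow_mul, mul_comm p, pow_mul, pow_mul (Z ω)]
      have e1 : (Z ω + 4) ^ 2 ≤ 2 * (Z ω ^ 2 + 16) := by nlinarith [sq_nonneg (Z ω - 4)]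
      calc ((Z ω + 4) ^ 2) ^ p ≤ (2 * (Z ω ^ 2 + 16)) ^ p := by gcongr
        _ = 2 ^ p * (Z ω ^ 2 + 16) ^ p := mul_pow _ _ _
        _ ≤ 2 ^ p * (2 ^ (p - 1) * ((Z ω ^ 2) ^ p + 16 ^ p)) := by
            gcongr; exact add_pow_le (by positivity) (by norm_num) p
        _ ≤ 2 ^ p * (2 ^ p * ((Z ω ^ 2) ^ p + 16 ^ p)) := by
            gcongr
            · norm_num
            · omega
        _ = _ := by rw [← mul_assoc, ← mul_pow]; norm_num
    refine (bernoulliExp_mono h0 h1 e).trans (le_of_eq ?_)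
    rw [bernoulliExp_mul_left, bernoulliExp_add, bernoulliExp_const]
  have hX0 : 0 ≤ X := bernoulliExp_nonneg h0 h1 fun ω => pow_nonneg (hZ0 ω) _
  refine le_pow_of_sq_le (by positivity) hsmall hp ?_
  set Q := bernoulliExp q (fun ω => (Z ω + 4) ^ p * Real.exp (sampleSize ω / m) ^ p) with hQ
  have h9 : (9 : ℝ) ≤ 9 ^ p := by
    calc (9 : ℝ) = 9 ^ 1 := by norm_num
      _ ≤ 9 ^ p := pow_le_pow_right₀ (by norm_num) (Nat.one_le_iff_ne_zero.2 hp)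
  calc X ^ 2 ≤ (2 ^ (2 * p) * (3 * (C * b * G) ^ p * Q)) ^ 2 := by gcongr
    _ = 9 * (16 * (C * b * G) ^ 2) ^ p * Q ^ 2 := by
        rw [mul_pow 16, show (16 : ℝ) = (2 ^ 2) ^ 2 by norm_num, ← pow_mul, ← pow_mul, ← pow_mul]
        ring
    _ ≤ 9 ^ p * (16 * (C * b * G) ^ 2) ^ p * (4 ^ p * (X + 16 ^ p) * 55 ^ p) := by
        gcongr
        exact hCS.trans (mul_le_mul hZ4 hexp
          (bernoulliExp_nonneg h0 h1 fun _ => by positivity) (by positivity))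
    _ = (9 * (16 * (C * b * G) ^ 2) * 4 * 55) ^ p * (X + 16 ^ p) := by
        simp only [mul_pow]; ring
    _ ≤ ((180 * C * (b * G)) ^ 2) ^ p * (X + 16 ^ p) := by
        gcongr ?_ ^ p * _
        nlinarith [sq_nonneg (C * b * G)]
    _ = _ := by rw [← pow_mul]

/-- The tail bound which follows from the moment bound by Markov's inequality. -/
theorem sum_bernoulliWeight_quadratic_process_le [DecidableEq ι] [DecidableEq κ] {T : Type*}
    [Fintype T] [DecidableEq T] (pos : T → ι → ℂ)
    (o : T) (ho : pos o = 0) (F : Matrix κ ι ℂ) {β : ℝ} (hβ : 0 < β) (hF : ∀ j i, ‖F j i‖ ≤ β)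
    {ξ K : ℕ} (hξ : ξ ≠ 0) (hK : ξ ≤ 4 ^ K) (hpos : ∀ x, ∑ i, ‖pos x i‖ ≤ 2 * √ξ)
    (hn : 2 ≤ Fintype.card ι)
    (hT : (Fintype.card T : ℝ) ≤ Real.exp (21 * ξ * Real.log (Fintype.card ι)))
    {q m : ℝ} (h0 : 0 ≤ q) (h1 : q ≤ 1) (hqm : q * Fintype.card κ = m) (hm : 2 ≤ m)
    (hE : ∀ x, q * ∑ j, ‖F.mulVec (pos x) j‖ ^ 2 ≤ 4) {p : ℕ} (hp : p ≠ 0) (hpm : 2 * p ≤ m)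
    {τ : ℝ} (hτ0 : 0 < τ) (hτ1 : τ < 1)
    (hsmall : 12960 * momentConst * ((ξ * β ^ 2) *
      (p + (K + 1) ^ 2 * (7 * Real.log m * Real.log (Fintype.card ι)))) ≤ τ ^ 2)
    (s : Finset (κ → Bool)) (hs : ∀ ω ∈ s,
      τ / 2 ≤ ‖fun x => ∑ j, (indic (ω j) - q) * ‖F.mulVec (pos x) j‖ ^ 2‖) :
    ∑ ω ∈ s, bernoulliWeight q ω ≤ Real.exp (-p) := by
  set B : ℝ := (ξ * β ^ 2) *
      (p + (K + 1) ^ 2 * (7 * Real.log m * Real.log (Fintype.card ι))) with hB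
  have hn2 : (2 : ℝ) ≤ Fintype.card ι := by exact_mod_cast hn
  have hy0 : 0 ≤ Real.log (Fintype.card ι) := Real.log_nonneg (by linarith)
  have hlm0 : 0 ≤ Real.log m := Real.log_nonneg (by linarith)
  have hB0 : 0 ≤ B := by positivity
  have hmc : (0 : ℝ) < momentConst := by norm_num [momentConst]
  have hmom := bernoulliExp_quadratic_process_le pos o ho F hβ hF hξ hK hpos hn hT h0 h1 hqm hm hE
    hp hpm (by rw [← hB]; nlinarith)
  have hmar := bernoulliExp_markov h0 h1 (fun ω : κ → Bool => pow_nonneg (norm_nonneg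
      (fun x => ∑ j, (indic (ω j) - q) * ‖F.mulVec (pos x) j‖ ^ 2)) (2 * p))
    (t := (τ / 2) ^ (2 * p)) (by positivity) s
    (fun ω hω => pow_le_pow_left₀ (by positivity) (hs ω hω) _)
  refine hmar.trans ?_
  rw [div_le_iff₀ (by positivity)]
  refine hmom.trans ?_
  rw [← hB, pow_mul (τ / 2), show -(p : ℝ) = p * (-1) by ring, Real.exp_nat_mul, ← mul_pow]
  refine pow_le_pow_left₀ (by positivity) ?_ p
  have he : 1 / 3 ≤ Real.exp (-1) := by
    rw [Real.exp_neg, ← one_div]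
    exact one_div_le_one_div_of_le (Real.exp_pos 1) (by linarith [Real.exp_one_lt_d9])
  calc 6 * (180 * momentConst * B) ≤ 1 / 3 * (τ / 2) ^ 2 := by nlinarith
    _ ≤ _ := by gcongr

end Moments

/-! ### A finite grid of sparse vectors -/

section Grid

variable {ι κ : Type*} [Fintype ι] [DecidableEq ι] [Fintype κ]

/-- The complex numbers `(a + b √-1) / L` with integers `|a|, |b| ≤ L`. -/
noncomputable def gridValues (L : ℕ) : Finset ℂ :=
  (Finset.Icc (-(L : ℤ)) L ×ˢ Finset.Icc (-(L : ℤ)) L).image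
    fun z => ((z.1 : ℂ) + (z.2 : ℂ) * Complex.I) / L

theorem card_gridValues_le (L : ℕ) : (gridValues L).card ≤ (2 * L + 1) ^ 2 := by
  refine Finset.card_image_le.trans (le_of_eq ?_)
  rw [Finset.card_product, Int.card_Icc, sq]
  congr 1 <;> omega

/-- The vectors supported on `ξ` coordinates, with entries in the grid and squared norm at most `4`. -/
noncomputable def sparseGrid (ι : Type*) [Fintype ι] [DecidableEq ι] (ξ L : ℕ) : Finset (ι → ℂ) :=
  ((Finset.powersetCard ξ Finset.univ).biUnion fun s =>
    Fintype.piFinset fun i => if i ∈ s then gridValues L else {0}).filter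
      fun y => ∑ i, ‖y i‖ ^ 2 ≤ 4

theorem card_sparseGrid_le (ξ L : ℕ) :
    (sparseGrid ι ξ L).card ≤ (Fintype.card ι * (2 * L + 1) ^ 2) ^ ξ := by
  refine (Finset.card_filter_le _ _).trans ?_
  refine (Finset.card_biUnion_le_card_mul _ _ (((2 * L + 1) ^ 2) ^ ξ) fun s hs => ?_).trans ?_
  · rw [Fintype.card_piFinset]
    have h : ∀ i, (if i ∈ s then gridValues L else {0}).card
        = if i ∈ s then (gridValues L).card else 1 := by
      intro i; split_ifs <;> simp
    simp only [h, Finset.prod_ite_mem, Finset.univ_inter, Finset.prod_const,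
      (Finset.mem_powersetCard.1 hs).2]
    exact Nat.pow_le_pow_left (card_gridValues_le L) ξ
  · rw [Finset.card_powersetCard, Finset.card_univ, mul_pow]
    exact Nat.mul_le_mul_right _ (Nat.choose_le_pow _ _)

theorem sum_norm_sq_le_of_mem_sparseGrid {ξ L : ℕ} {y : ι → ℂ} (hy : y ∈ sparseGrid ι ξ L) :
    ∑ i, ‖y i‖ ^ 2 ≤ 4 :=
  (Finset.mem_filter.1 hy).2

theorem sum_norm_le_of_mem_sparseGrid {ξ L : ℕ} {y : ι → ℂ} (hy : y ∈ sparseGrid ι ξ L) :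
    ∑ i, ‖y i‖ ≤ 2 * √ξ := by
  have h2 := sum_norm_sq_le_of_mem_sparseGrid hy
  obtain ⟨s, hs, hys⟩ := Finset.mem_biUnion.1 (Finset.mem_filter.1 hy).1
  have hcard := (Finset.mem_powersetCard.1 hs).2
  have h0 : ∀ i ∉ s, y i = 0 := by
    intro i hi
    have := Fintype.mem_piFinset.1 hys i
    simpa [hi] using this
  have e : ∑ i, ‖y i‖ = ∑ i ∈ s, ‖y i‖ :=
    (Finset.sum_subset (Finset.subset_univ s) fun i _ hi => by simp [h0 i hi]).symm
  have h1 := sq_sum_le_card_mul_sum_sq (s := s) (f := fun i => ‖y i‖)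
  have h3 : ∑ i ∈ s, ‖y i‖ ^ 2 ≤ ∑ i, ‖y i‖ ^ 2 :=
    Finset.sum_le_sum_of_subset_of_nonneg (Finset.subset_univ s) fun _ _ _ => by positivity
  rw [e]
  refine abs_le_of_sq_le_sq' ?_ (by positivity) |>.2
  rw [mul_pow, Real.sq_sqrt (Nat.cast_nonneg ξ)]
  rw [hcard] at h1
  calc _ ≤ (ξ : ℝ) * ∑ i ∈ s, ‖y i‖ ^ 2 := h1
    _ ≤ ξ * 4 := by gcongr; linarith
    _ = _ := by ring

theorem exists_mem_gridValues_norm_sub_le {L : ℕ} (hL : L ≠ 0) {z : ℂ} (hz : ‖z‖ ≤ 1) :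
    ∃ w ∈ gridValues L, ‖z - w‖ ≤ 2 / L := by
  have hL0 : (0 : ℝ) < L := by exact_mod_cast Nat.pos_of_ne_zero hL
  have key : ∀ t : ℝ, |t| ≤ 1 → ⌊t * L⌋ ∈ Finset.Icc (-(L : ℤ)) L ∧ |t - ⌊t * L⌋ / L| ≤ 1 / L := by
    intro t ht
    have ht' := abs_le.1 ht
    have f1 := Int.floor_le (t * L)
    have f2 := Int.lt_floor_add_one (t * L)
    refine ⟨Finset.mem_Icc.2 ⟨?_, ?_⟩, ?_⟩
    · rw [Int.le_floor]; push_cast; nlinarith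
    · have : (⌊t * L⌋ : ℝ) ≤ L := by nlinarith
      exact_mod_cast this
    · have e : t - ⌊t * L⌋ / L = (t * L - ⌊t * L⌋) / L := by field_simp
      rw [e, abs_div, abs_of_pos hL0]
      gcongr
      rw [abs_le]; constructor <;> linarith
  obtain ⟨r1, r2⟩ := key z.re ((Complex.abs_re_le_norm z).trans hz)
  obtain ⟨i1, i2⟩ := key z.im ((Complex.abs_im_le_norm z).trans hz)
  refine ⟨((⌊z.re * L⌋ : ℂ) + (⌊z.im * L⌋ : ℂ) * Complex.I) / L,
    Finset.mem_image.2 ⟨(⌊z.re * L⌋, ⌊z.im * L⌋), Finset.mk_mem_product r1 i1, rfl⟩, ?_⟩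
  have e : z - ((⌊z.re * L⌋ : ℂ) + (⌊z.im * L⌋ : ℂ) * Complex.I) / L
      = ((z.re - ⌊z.re * L⌋ / L : ℝ) : ℂ) + ((z.im - ⌊z.im * L⌋ / L : ℝ) : ℂ) * Complex.I := by
    nth_rewrite 1 [← Complex.re_add_im z]
    push_cast
    ring
  rw [e]
  refine (norm_add_le _ _).trans ?_
  rw [norm_mul, Complex.norm_I, mul_one, Complex.norm_real, Complex.norm_real, Real.norm_eq_abs,
    Real.norm_eq_abs]
  calc _ ≤ 1 / (L : ℝ) + 1 / L := add_le_add r2 i2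
    _ = _ := by ring

theorem zero_mem_sparseGrid {ξ L : ℕ} (hξ : ξ ≤ Fintype.card ι) :
    (0 : ι → ℂ) ∈ sparseGrid ι ξ L := by
  obtain ⟨s, -, hs⟩ := Finset.exists_subset_card_eq (s := (Finset.univ : Finset ι)) (n := ξ)
    (by simpa using hξ)
  refine Finset.mem_filter.2 ⟨Finset.mem_biUnion.2 ⟨s, by simp [Finset.mem_powersetCard, hs],
    Fintype.mem_piFinset.2 fun i => ?_⟩, by simp⟩
  split_ifs
  · exact Finset.mem_image.2 ⟨(0, 0), Finset.mk_mem_product (by simp) (by simp), by simp⟩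
  · simp

theorem exists_mem_sparseGrid_norm_sub_le {ξ L : ℕ} (hξ : ξ ≤ Fintype.card ι)
    (hn : Fintype.card ι ≠ 0) (hL : 4 * Fintype.card ι ≤ L) {x : ι → ℂ}
    (hx : (Finset.univ.filter fun i => x i ≠ 0).card ≤ ξ) (hx1 : ∑ i, ‖x i‖ ^ 2 = 1) :
    ∃ y ∈ sparseGrid ι ξ L, ∀ i, ‖x i - y i‖ ≤ 2 / L := by
  have hL0 : L ≠ 0 := by omega
  have hLpos : (0 : ℝ) < L := by exact_mod_cast Nat.pos_of_ne_zero hL0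
  have hxi : ∀ i, ‖x i‖ ≤ 1 := by
    intro i
    have := Finset.single_le_sum (f := fun i => ‖x i‖ ^ 2) (fun i _ => by positivity)
      (Finset.mem_univ i)
    rw [hx1] at this
    nlinarith [norm_nonneg (x i)]
  choose w hw hwx using fun i => exists_mem_gridValues_norm_sub_le hL0 (hxi i)
  obtain ⟨s, hsub, -, hs⟩ := Finset.exists_subsuperset_card_eq
    (Finset.subset_univ (Finset.univ.filter fun i => x i ≠ 0)) hx (by simpa using hξ)
  set y : ι → ℂ := fun i => if i ∈ s then w i else 0 with hy
  have hxy : ∀ i, ‖x i - y i‖ ≤ 2 / L := by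
    intro i
    by_cases hi : i ∈ s
    · simp only [hy, hi, if_true]; exact hwx i
    · have : x i = 0 := by
        by_contra h
        exact hi (hsub (by simp [h]))
      simp only [hy, hi, if_false, this, sub_zero, norm_zero]
      positivity
  refine ⟨y, Finset.mem_filter.2 ⟨Finset.mem_biUnion.2 ⟨s, by simp [Finset.mem_powersetCard, hs],
    Fintype.mem_piFinset.2 fun i => ?_⟩, ?_⟩, hxy⟩
  · by_cases hi : i ∈ s
    · simp only [hy, hi, if_true]; exact hw i
    · simp [hy, hi]
  · have hL4 : (4 * Fintype.card ι : ℝ) ≤ L := by exact_mod_cast hL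
    have hn1 : (1 : ℝ) ≤ Fintype.card ι := by exact_mod_cast Nat.pos_of_ne_zero hn
    have h2L : (2 : ℝ) / L ≤ 1 / 2 := by
      rw [div_le_div_iff₀ hLpos (by norm_num)]; linarith
    have hpt : ∀ i, ‖y i‖ ^ 2 ≤ ‖x i‖ ^ 2 + 6 / L := by
      intro i
      have h1 : ‖y i‖ ≤ ‖x i‖ + 2 / L := by
        have := norm_sub_norm_le (y i) (x i)
        rw [norm_sub_rev] at this
        linarith [hxy i]
      have h3 : 0 ≤ (2 : ℝ) / L := by positivity
      calc ‖y i‖ ^ 2 ≤ (‖x i‖ + 2 / L) ^ 2 := by gcongr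
        _ = ‖x i‖ ^ 2 + 2 / L * (2 * ‖x i‖ + 2 / L) := by ring
        _ ≤ ‖x i‖ ^ 2 + 2 / L * 3 := by
            gcongr; linarith [hxi i]
        _ = _ := by ring
    refine (Finset.sum_le_sum fun i _ => hpt i).trans ?_
    rw [Finset.sum_add_distrib, hx1, Finset.sum_const, Finset.card_univ, nsmul_eq_mul]
    have : (Fintype.card ι : ℝ) * (6 / L) ≤ 3 := by
      rw [mul_div_assoc', div_le_iff₀ hLpos]; linarith
    linarith

/-- Passing from the grid to all sparse vectors: for entries `‖F j i‖ ≤ 1` the quadratic form moves by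
at most `6 n ^ 2 k / L` between a unit vector and its approximation. -/
theorem abs_quadratic_le_of_sparseGrid {ξ L : ℕ} (hξ : ξ ≤ Fintype.card ι)
    (hn : Fintype.card ι ≠ 0) (hL : 4 * Fintype.card ι ≤ L) (F : Matrix κ ι ℂ)
    (hF : ∀ j i, ‖F j i‖ ≤ 1) (c : κ → ℝ) (hc : ∀ j, |c j| ≤ 1) {z : ℝ}
    (hz : ∀ y ∈ sparseGrid ι ξ L, |∑ j, c j * ‖F.mulVec y j‖ ^ 2| ≤ z) {x : ι → ℂ}
    (hx : (Finset.univ.filter fun i => x i ≠ 0).card ≤ ξ) :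
    |∑ j, c j * ‖F.mulVec x j‖ ^ 2|
      ≤ (z + Fintype.card κ * (6 * Fintype.card ι ^ 2 / L)) * ∑ i, ‖x i‖ ^ 2 := by
  have hL0 : L ≠ 0 := by omega
  have hLpos : (0 : ℝ) < L := by exact_mod_cast Nat.pos_of_ne_zero hL0
  have hL4 : (4 * Fintype.card ι : ℝ) ≤ L := by exact_mod_cast hL
  have hn1 : (1 : ℝ) ≤ Fintype.card ι := by exact_mod_cast Nat.pos_of_ne_zero hn
  set n : ℝ := (Fintype.card ι : ℝ) with hndef
  have hunit : ∀ x : ι → ℂ, (Finset.univ.filter fun i => x i ≠ 0).card ≤ ξ → ∑ i, ‖x i‖ ^ 2 = 1 →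
      |∑ j, c j * ‖F.mulVec x j‖ ^ 2| ≤ z + Fintype.card κ * (6 * n ^ 2 / L) := by
    intro x hx hx1
    obtain ⟨y, hy, hxy⟩ := exists_mem_sparseGrid_norm_sub_le hξ hn hL hx hx1
    have hxi : ∀ i, ‖x i‖ ≤ 1 := by
      intro i
      have := Finset.single_le_sum (f := fun i => ‖x i‖ ^ 2) (fun i _ => by positivity)
        (Finset.mem_univ i)
      rw [hx1] at this
      nlinarith [norm_nonneg (x i)]
    have h2L : (2 : ℝ) / L ≤ 1 := by
      rw [div_le_one hLpos]; linarith
    have hyi : ∀ i, ‖y i‖ ≤ 2 := by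
      intro i
      have := norm_sub_norm_le (y i) (x i)
      rw [norm_sub_rev] at this
      linarith [hxy i, hxi i]
    have hsum : ∀ (u : ι → ℂ) (a : ℝ), (∀ i, ‖u i‖ ≤ a) → ∑ i, ‖u i‖ ≤ n * a := by
      intro u a h
      refine (Finset.sum_le_sum fun i _ => h i).trans (le_of_eq ?_)
      rw [Finset.sum_const, Finset.card_univ, nsmul_eq_mul]
    have hpt : ∀ j, |c j * ‖F.mulVec x j‖ ^ 2 - c j * ‖F.mulVec y j‖ ^ 2| ≤ 6 * n ^ 2 / L := by
      intro j
      have b1 := norm_mulVec_le F zero_le_one hF (hsum x 1 hxi) j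
      have b2 := norm_mulVec_le F zero_le_one hF (hsum y 2 hyi) j
      have b3 := norm_mulVec_le F zero_le_one hF (hsum (x - y) (2 / L) hxy) j
      rw [Matrix.mulVec_sub, Pi.sub_apply] at b3
      have b4 := (abs_norm_sub_norm_le (F.mulVec x j) (F.mulVec y j)).trans b3
      have e : c j * ‖F.mulVec x j‖ ^ 2 - c j * ‖F.mulVec y j‖ ^ 2
          = c j * ((‖F.mulVec x j‖ - ‖F.mulVec y j‖) * (‖F.mulVec x j‖ + ‖F.mulVec y j‖)) := by
        ring
      rw [e, abs_mul, abs_mul, abs_of_nonneg (show 0 ≤ ‖F.mulVec x j‖ + ‖F.mulVec y j‖ by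
        positivity)]
      calc _ ≤ 1 * (1 * (n * (2 / L)) * (3 * n)) := by
            gcongr
            · exact hc j
            · linarith
        _ = _ := by ring
    have hdiff : |∑ j, c j * ‖F.mulVec x j‖ ^ 2 - ∑ j, c j * ‖F.mulVec y j‖ ^ 2|
        ≤ Fintype.card κ * (6 * n ^ 2 / L) := by
      rw [← Finset.sum_sub_distrib]
      refine (Finset.abs_sum_le_sum_abs _ _).trans
        ((Finset.sum_le_sum fun j _ => hpt j).trans (le_of_eq ?_))
      rw [Finset.sum_const, Finset.card_univ, nsmul_eq_mul]
    have h1 := hz y hy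
    have h2 := abs_sub_abs_le_abs_sub (∑ j, c j * ‖F.mulVec x j‖ ^ 2)
      (∑ j, c j * ‖F.mulVec y j‖ ^ 2)
    linarith
  rcases (Finset.sum_nonneg fun i (_ : i ∈ Finset.univ) => sq_nonneg ‖x i‖).eq_or_lt with h0 | h0
  · have : x = 0 := by
      funext i
      have := (Finset.sum_eq_zero_iff_of_nonneg fun i _ => sq_nonneg ‖x i‖).1 h0.symm i
        (Finset.mem_univ i)
      simpa using this
    simp [this]
  · set N := ∑ i, ‖x i‖ ^ 2 with hN
    set a : ℂ := (((√N)⁻¹ : ℝ) : ℂ) with ha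
    have hsN : 0 < √N := Real.sqrt_pos.2 h0
    have hna : ‖a‖ ^ 2 = N⁻¹ := by
      rw [ha, Complex.norm_real, Real.norm_eq_abs, sq_abs, inv_pow, Real.sq_sqrt h0.le]
    have h := hunit (a • x) (by
      refine (Finset.card_le_card fun i hi => ?_).trans hx
      simp only [Finset.mem_filter, Finset.mem_univ, true_and, Pi.smul_apply, smul_eq_mul] at hi ⊢
      exact fun h => hi (by rw [h, mul_zero])) (by
      simp only [Pi.smul_apply, smul_eq_mul, norm_mul, mul_pow, hna, ← Finset.mul_sum, ← hN]
      exact inv_mul_cancel₀ h0.ne')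
    have e : ∀ j, c j * ‖F.mulVec (a • x) j‖ ^ 2 = N⁻¹ * (c j * ‖F.mulVec x j‖ ^ 2) := by
      intro j
      rw [Matrix.mulVec_smul, Pi.smul_apply, smul_eq_mul, norm_mul, mul_pow, hna]; ring
    simp only [e, ← Finset.mul_sum] at h
    rw [abs_mul, abs_of_pos (inv_pos.2 h0), inv_mul_le_iff₀ h0] at h
    linarith

end Grid

/-! ### Parameters, sampling and the restricted isometry constant -/

section Parameters

/-- The choice of the order `p` of the moments and of the number `K` of levels of the chaining, and the
consequences of the lower bound on `m`. -/
theorem exists_moment_order_and_levels {m n Υ τ η : ℝ} {ξ : ℕ} (hm : 2 ≤ m) (hmn : m ≤ n)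
    (hΥ : 1 ≤ Υ) (hξ : 2 ≤ ξ) (hτ0 : 0 < τ) (hτ1 : τ < 1) (hη0 : 0 < η) (hη1 : η < 1)
    (h : (ξ : ℝ) * Υ ^ 2 * (τ ^ 2)⁻¹ *
      max (1762560 * momentConst * Real.log ξ ^ 2 * Real.log m * Real.log n)
        (25920 * momentConst * Real.log η⁻¹) ≤ m) :
    (ξ : ℝ) ≤ m ∧ Υ ^ 2 ≤ m ∧ 1 ≤ m * τ ∧ ∃ p K : ℕ, p ≠ 0 ∧ ξ ≤ 4 ^ K ∧ 2 * (p : ℝ) ≤ m ∧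
      Real.exp (-p) ≤ η ∧ 12960 * momentConst * ((ξ * (Υ ^ 2 / m)) *
        (p + (K + 1) ^ 2 * (7 * Real.log m * Real.log n))) ≤ τ ^ 2 := by
  have hξ2 : (2 : ℝ) ≤ ξ := by exact_mod_cast hξ
  have hm0 : 0 < m := by linarith
  have hlog : ∀ t : ℝ, 2 ≤ t → 0.69 ≤ Real.log t := fun t ht => by
    have := Real.log_le_log (by norm_num) ht
    linarith [Real.log_two_gt_d9]
  have l1 := hlog ξ hξ2
  have l2 := hlog m hm
  have l3 := hlog n (hm.trans hmn)
  set Λ := Real.log ξ ^ 2 * (Real.log m * Real.log n) with hΛ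
  have hΛ1 : 1 / 5 ≤ Λ := by
    calc (1 : ℝ) / 5 ≤ 0.69 ^ 2 * (0.69 * 0.69) := by norm_num
      _ ≤ _ := by rw [hΛ]; gcongr
  set ℓ := Real.log η⁻¹ with hℓ
  have hℓ0 : 0 < ℓ := Real.log_pos ((one_lt_inv₀ hη0).2 hη1)
  set D : ℝ := momentConst with hD
  have hD1 : 1 ≤ D := by norm_num [hD, momentConst]
  set a : ℝ := ξ * Υ ^ 2 * (τ ^ 2)⁻¹ with ha
  have hΥ2 : 1 ≤ Υ ^ 2 := one_le_pow₀ hΥ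
  have hτ2 : 1 ≤ (τ ^ 2)⁻¹ := (one_le_inv₀ (by positivity)).2 (pow_le_one₀ hτ0.le hτ1.le)
  have ha1 : (ξ : ℝ) ≤ a := by
    rw [ha, mul_assoc]
    exact le_mul_of_one_le_right (by positivity) (one_le_mul_of_one_le_of_one_le hΥ2 hτ2)
  have ha2 : Υ ^ 2 ≤ a := by
    rw [ha, mul_right_comm]
    exact le_mul_of_one_le_left (by positivity)
      (one_le_mul_of_one_le_of_one_le (by linarith) hτ2)
  have ha3 : (τ ^ 2)⁻¹ ≤ a :=
    le_mul_of_one_le_left (by positivity) (one_le_mul_of_one_le_of_one_le (by linarith) hΥ2)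
  have ha0 : 0 < a := by linarith
  have hA : a * (1762560 * D * Λ) ≤ m := by
    refine le_trans ?_ h
    gcongr
    refine le_trans (le_of_eq ?_) (le_max_left _ _)
    rw [hΛ]; ring
  have hB : a * (25920 * D * ℓ) ≤ m := by
    refine le_trans ?_ h
    gcongr
    exact le_max_right _ _
  have hDΛ : 4 ≤ 1762560 * D * Λ := by nlinarith
  have ham : a ≤ m := by nlinarith
  refine ⟨ha1.trans ham, ha2.trans ham, ?_, ⌈ℓ⌉₊, Nat.log 2 ξ, ?_, ?_, ?_, ?_, ?_⟩
  · have h1 : (τ ^ 2)⁻¹ ≤ m := ha3.trans ham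
    rw [inv_le_iff_one_le_mul₀ (by positivity)] at h1
    nlinarith
  · exact (Nat.ceil_pos.2 hℓ0).ne'
  · have h1 : ξ < 2 ^ (Nat.log 2 ξ + 1) := Nat.lt_pow_succ_log_self (by norm_num) ξ
    have h2 : 1 ≤ Nat.log 2 ξ := Nat.log_pos (by norm_num) hξ
    calc ξ ≤ 2 ^ (Nat.log 2 ξ + 1) := h1.le
      _ ≤ 2 ^ (2 * Nat.log 2 ξ) := Nat.pow_le_pow_right (by norm_num) (by omega)
      _ = _ := by rw [pow_mul]; norm_num
  · have h1 := Nat.ceil_lt_add_one hℓ0.le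
    have h2 : 4 ≤ m := by nlinarith
    have h3 : 4 * ℓ ≤ m := by
      have h4 : 4 * ℓ ≤ 25920 * D * ℓ := by gcongr; linarith
      have h5 : 25920 * D * ℓ ≤ a * (25920 * D * ℓ) :=
        le_mul_of_one_le_left (by positivity) (by linarith)
      linarith
    linarith
  · have h1 := Nat.le_ceil ℓ
    calc Real.exp (-(⌈ℓ⌉₊ : ℝ)) ≤ Real.exp (-ℓ) := by gcongr
      _ = η := by rw [hℓ, Real.log_inv, neg_neg, Real.exp_log hη0]
  · have h1 := Nat.ceil_lt_add_one hℓ0.le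
    have h2 : 1 ≤ Nat.log 2 ξ := Nat.log_pos (by norm_num) hξ
    have h3 : ((Nat.log 2 ξ : ℕ) : ℝ) * Real.log 2 ≤ Real.log ξ := by
      rw [← Real.log_pow]
      refine Real.log_le_log (by positivity) ?_
      exact_mod_cast Nat.pow_log_le_self 2 (by omega)
    have h4 : ((Nat.log 2 ξ : ℕ) : ℝ) + 1 ≤ 3 * Real.log ξ := by
      have h5 : (1 : ℝ) ≤ (Nat.log 2 ξ : ℕ) := by exact_mod_cast h2
      nlinarith [Real.log_two_gt_d9]
    have h6 : (((Nat.log 2 ξ : ℕ) : ℝ) + 1) ^ 2 * (7 * Real.log m * Real.log n) ≤ 63 * Λ := by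
      calc _ ≤ (3 * Real.log ξ) ^ 2 * (7 * Real.log m * Real.log n) := by gcongr
        _ = _ := by rw [hΛ]; ring
    have hab : ξ * (Υ ^ 2 / m) = a / m * τ ^ 2 := by
      rw [ha]; field_simp
    have h7 : a / m * (25920 * D * ℓ) ≤ 1 := by
      rw [div_mul_eq_mul_div, div_le_one hm0]; exact hB
    have h8 : a / m * (1762560 * D * Λ) ≤ 1 := by
      rw [div_mul_eq_mul_div, div_le_one hm0]; exact hA
    calc _ ≤ 12960 * D * ((ξ * (Υ ^ 2 / m)) * (ℓ + 68 * Λ)) := by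
          refine mul_le_mul_of_nonneg_left ?_ (by positivity)
          refine mul_le_mul_of_nonneg_left ?_ (by positivity)
          linarith
      _ = (a / m * (25920 * D * ℓ) / 2 + a / m * (1762560 * D * Λ) / 2) * τ ^ 2 := by
          rw [hab]; ring
      _ ≤ 1 * τ ^ 2 := by gcongr; linarith
      _ = _ := one_mul _

end Parameters

section Sampling

variable {ι : Type*} [Fintype ι] [DecidableEq ι]

theorem sum_norm_sq_mulVec_of_unitary {U : Matrix ι ι ℂ} (hU : U.conjTranspose * U = 1)
    (x : ι → ℂ) : ∑ j, ‖U.mulVec x j‖ ^ 2 = ∑ i, ‖x i‖ ^ 2 := by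
  have key : ∀ y : ι → ℂ, ((∑ i, ‖y i‖ ^ 2 : ℝ) : ℂ) = dotProduct (star y) y := by
    intro y
    rw [dotProduct, Complex.ofReal_sum]
    refine Finset.sum_congr rfl fun i _ => ?_
    rw [Pi.star_apply, ← Complex.normSq_eq_norm_sq, Complex.normSq_eq_conj_mul_self]
    rfl
  have h : ((∑ j, ‖U.mulVec x j‖ ^ 2 : ℝ) : ℂ) = ((∑ i, ‖x i‖ ^ 2 : ℝ) : ℂ) := by
    rw [key, key, Matrix.star_mulVec, Matrix.dotProduct_mulVec, Matrix.vecMul_vecMul, hU,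
      Matrix.vecMul_one]
  exact_mod_cast h

/-- The patterns for which the sampled and normalized unitary matrix distorts the energy of some sparse
vector by a factor `τ` have small probability. -/
theorem sum_bernoulliWeight_of_distortion_le {U : Matrix ι ι ℂ} (hU : U.conjTranspose * U = 1)
    {m Υ τ η : ℝ} {ξ : ℕ} (hm : 2 ≤ m) (hmn : m ≤ Fintype.card ι) (hΥ : 1 ≤ Υ)
    (hUΥ : ∀ i j, √(Fintype.card ι) * ‖U i j‖ ≤ Υ)
    (hξ : 2 ≤ ξ) (hτ0 : 0 < τ) (hτ1 : τ < 1) (hη0 : 0 < η) (hη1 : η < 1)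
    (h : (ξ : ℝ) * Υ ^ 2 * (τ ^ 2)⁻¹ *
      max (1762560 * momentConst * Real.log ξ ^ 2 * Real.log m * Real.log (Fintype.card ι))
        (25920 * momentConst * Real.log η⁻¹) ≤ m)
    (s : Finset (ι → Bool))
    (hs : ∀ ω ∈ s, ∀ t < τ, ∃ x : ι → ℂ, (Finset.univ.filter fun i => x i ≠ 0).card ≤ ξ ∧
      t * ∑ i, ‖x i‖ ^ 2 < |∑ j, (indic (ω j) - m / Fintype.card ι) *
        (Fintype.card ι / m * ‖U.mulVec x j‖ ^ 2)|) :
    ∑ ω ∈ s, bernoulliWeight (m / Fintype.card ι) ω ≤ η := by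
  set N := Fintype.card ι with hN
  have hm0 : 0 < m := by linarith
  have hN2 : (2 : ℝ) ≤ N := hm.trans hmn
  have hN0 : (0 : ℝ) < N := by linarith
  have hNn : 2 ≤ N := by exact_mod_cast hN2
  obtain ⟨hξm, hΥm, hmτ, p, K, hp, hK, hpm, hpη, hsmall⟩ :=
    exists_moment_order_and_levels hm hmn hΥ hξ hτ0 hτ1 hη0 hη1 h
  have hξN : ξ ≤ N := by exact_mod_cast hξm.trans hmn
  set q : ℝ := m / N with hq
  have hq0 : 0 ≤ q := by positivity
  have hq1 : q ≤ 1 := (div_le_one hN0).2 hmn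
  set F : Matrix ι ι ℂ := ((√(N / m) : ℝ) : ℂ) • U with hF
  have hFsq : ∀ x j, ‖F.mulVec x j‖ ^ 2 = N / m * ‖U.mulVec x j‖ ^ 2 := by
    intro x j
    rw [hF, Matrix.smul_mulVec, Pi.smul_apply, smul_eq_mul, norm_mul, mul_pow,
      Complex.norm_real, Real.norm_eq_abs, sq_abs, Real.sq_sqrt (by positivity)]
  set β : ℝ := Υ / √m with hβ
  have hsm : 0 < √m := Real.sqrt_pos.2 hm0
  have hβ0 : 0 < β := by positivity
  have hβsq : β ^ 2 = Υ ^ 2 / m := by rw [hβ, div_pow, Real.sq_sqrt hm0.le]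
  have hFβ : ∀ j i, ‖F j i‖ ≤ β := by
    intro j i
    rw [hF, Matrix.smul_apply, smul_eq_mul, norm_mul, Complex.norm_real, Real.norm_eq_abs,
      abs_of_nonneg (Real.sqrt_nonneg _), Real.sqrt_div hN0.le, hβ, div_mul_eq_mul_div]
    gcongr
    exact hUΥ j i
  have hβ1 : β ≤ 1 := by
    have : β ^ 2 ≤ 1 := by rw [hβsq]; exact (div_le_one hm0).2 hΥm
    nlinarith
  -- The fineness of the grid makes the discretization error at most `τ / 4`.
  set L : ℕ := 24 * N ^ 4 with hL
  have hNpow : N ≤ N ^ 4 := Nat.le_self_pow (by norm_num) N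
  have hT : ((Fintype.card (sparseGrid ι ξ L) : ℕ) : ℝ) ≤ Real.exp (21 * ξ * Real.log N) := by
    rw [Fintype.card_coe]
    have h1 : (sparseGrid ι ξ L).card ≤ (N ^ 21) ^ ξ := by
      refine (card_sparseGrid_le ξ L).trans (Nat.pow_le_pow_left ?_ ξ)
      have h2 : 2 * L + 1 ≤ N ^ 10 := by
        have h3 : 2 ^ 6 * N ^ 4 ≤ N ^ 6 * N ^ 4 :=
          Nat.mul_le_mul_right _ (Nat.pow_le_pow_left hNn 6)
        have h4 : N ^ 10 = N ^ 6 * N ^ 4 := by ring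
        omega
      calc _ ≤ N * (N ^ 10) ^ 2 := Nat.mul_le_mul_left _ (Nat.pow_le_pow_left h2 2)
        _ = _ := by ring
    have h5 : Real.exp (21 * ξ * Real.log N) = ((N : ℝ) ^ 21) ^ ξ := by
      rw [← pow_mul, ← Real.exp_log hN0, ← Real.exp_nat_mul, Real.log_exp]
      push_cast; rfl
    rw [h5]
    exact_mod_cast h1
  have hzero := zero_mem_sparseGrid (ι := ι) (L := L) hξN
  have hE : ∀ x : sparseGrid ι ξ L, q * ∑ j, ‖F.mulVec (x : ι → ℂ) j‖ ^ 2 ≤ 4 := by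
    intro x
    simp only [hFsq, ← Finset.mul_sum, sum_norm_sq_mulVec_of_unitary hU]
    rw [hq, ← mul_assoc, div_mul_div_cancel₀ hN0.ne', div_self hm0.ne', one_mul]
    exact sum_norm_sq_le_of_mem_sparseGrid x.2
  refine (sum_bernoulliWeight_quadratic_process_le (fun x : sparseGrid ι ξ L => (x : ι → ℂ))
    ⟨0, hzero⟩ rfl F hβ0 hFβ (by omega) hK (fun x => sum_norm_le_of_mem_sparseGrid x.2) hNn hT hq0
    hq1 (div_mul_cancel₀ m hN0.ne') hm hE hp hpm hτ0 hτ1 (by rw [hβsq]; exact hsmall) s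
    fun ω hω => ?_).trans hpη
  by_contra! hcon
  set Z := ‖fun x : sparseGrid ι ξ L =>
    ∑ j, (indic (ω j) - q) * ‖F.mulVec (x : ι → ℂ) j‖ ^ 2‖ with hZ
  obtain ⟨x, hx, hlt⟩ := hs ω hω (Z + τ / 4) (by linarith)
  simp only [← hFsq] at hlt
  have hgrid := abs_quadratic_le_of_sparseGrid hξN (by omega) (L := L)
    (by rw [hL]; omega) F (fun j i => (hFβ j i).trans hβ1)
    (fun j => indic (ω j) - q) (by
      intro j
      rw [abs_le]
      cases ω j <;> simp only [indic, if_true, Bool.false_eq_true, if_false] <;>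
        constructor <;> linarith) (z := Z) (fun y hy => norm_le_pi_norm
      (fun x : sparseGrid ι ξ L => ∑ j, (indic (ω j) - q) * ‖F.mulVec (x : ι → ℂ) j‖ ^ 2)
      ⟨y, hy⟩) hx
  have herr : (N : ℝ) * (6 * N ^ 2 / L) ≤ τ / 4 := by
    have e : (N : ℝ) * (6 * N ^ 2 / L) = 1 / (4 * N) := by
      rw [hL]; push_cast; field_simp; norm_num
    have : m * τ ≤ N * τ := by gcongr
    rw [e, div_le_div_iff₀ (by positivity) (by norm_num)]
    linarith
  have hnn : 0 ≤ ∑ i, ‖x i‖ ^ 2 := Finset.sum_nonneg fun _ _ => sq_nonneg _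
  have : (Z + N * (6 * N ^ 2 / L)) * ∑ i, ‖x i‖ ^ 2 ≤ (Z + τ / 4) * ∑ i, ‖x i‖ ^ 2 := by
    gcongr
  linarith

open MeasureTheory ProbabilityTheory in
/-- The law of the pattern of independent selectors. -/
theorem measureReal_pattern_eq {Ω : Type*} [MeasurableSpace Ω] (μ : Measure Ω)
    [IsProbabilityMeasure μ] {N : ℕ} {J : Fin N → ℕ} {q : ℝ} {θ : MultiIndex J → Ω → ℝ}
    (hθ : IsBernoulliSelectors μ q θ) (a : MultiIndex J → Bool) :
    μ.real {ω | ∀ j, (θ j ω = 1 ↔ a j = true)} = bernoulliWeight q a := by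
  have hset : {ω | ∀ j, (θ j ω = 1 ↔ a j = true)}
      = ⋂ j ∈ Finset.univ, θ j ⁻¹' (if a j = true then {1} else {1}ᶜ) := by
    ext ω
    simp only [Set.mem_ofPred_eq, Finset.mem_univ, Set.iInter_true, Set.mem_iInter,
      Set.mem_preimage]
    refine forall_congr' fun j => ?_
    cases a j <;> simp
  rw [hset, Measure.real, hθ.indep.measure_inter_preimage_eq_mul Finset.univ (by
    intro j _
    split_ifs
    · exact measurableSet_singleton _
    · exact (measurableSet_singleton _).compl), ENNReal.toReal_prod, bernoulliWeight]
  refine Finset.prod_congr rfl fun j _ => ?_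
  change μ.real _ = _
  have h1 : μ.real (θ j ⁻¹' {1}) = q := hθ.prob_one j
  split_ifs
  · exact h1
  · rw [Set.preimage_compl, probReal_compl_eq_one_sub (hθ.measurable j (measurableSet_singleton _)),
      h1]

/-- The energy of a sampled tensor, as a sum over all the indices. -/
theorem frobeniusNorm_sampledTensor_sq {Ω : Type*} {M N : ℕ} (I : Fin M → ℕ) {J : Fin N → ℕ}
    (θ : MultiIndex J → Ω → ℝ) (ω : Ω) (a : MultiIndex J → Bool)
    (ha : ∀ j, (θ j ω = 1 ↔ a j = true)) (U : BiTensor (MultiIndex J) J) (X : Tensor J) :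
    frobeniusNorm ((sampledTensor I (selectedSet θ ω) U).mulVec X) ^ 2
      = ∑ j, indic (a j) * ((∏ k, (J k : ℝ)) / (∏ i, (I i : ℝ)) * ‖U.mulVec X j‖ ^ 2) := by
  have hmem : ∀ j, j ∈ selectedSet θ ω ↔ a j = true := by
    intro j
    simp [selectedSet, ha]
  have hrow : ∀ r : selectedSet θ ω, (restrictionTensor (selectedSet θ ω) * U).mulVec X r
      = U.mulVec X r := by
    intro r
    simp only [Matrix.mulVec, dotProduct, restrictionTensor_mul_apply]
  have hpos : 0 ≤ (∏ k, (J k : ℝ)) / ∏ i, (I i : ℝ) :=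
    div_nonneg (Finset.prod_nonneg fun _ _ => Nat.cast_nonneg _)
      (Finset.prod_nonneg fun _ _ => Nat.cast_nonneg _)
  rw [frobeniusNorm_sq]
  have h1 : ∀ r : selectedSet θ ω, ‖(sampledTensor I (selectedSet θ ω) U).mulVec X r‖ ^ 2
      = (∏ k, (J k : ℝ)) / (∏ i, (I i : ℝ)) * ‖U.mulVec X r‖ ^ 2 := by
    intro r
    rw [sampledTensor, Matrix.smul_mulVec, Pi.smul_apply, hrow, smul_eq_mul, norm_mul, mul_pow,
      Complex.norm_real, Real.norm_eq_abs, sq_abs, Real.sq_sqrt hpos]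
  simp only [h1]
  rw [Finset.sum_coe_sort (selectedSet θ ω)
    (fun j => (∏ k, (J k : ℝ)) / (∏ i, (I i : ℝ)) * ‖U.mulVec X j‖ ^ 2)]
  have h2 : selectedSet θ ω = Finset.univ.filter fun j => a j = true := by
    ext j; simp [hmem]
  rw [h2, Finset.sum_filter]
  refine Finset.sum_congr rfl fun j _ => ?_
  by_cases h : a j = true <;> simp [indic, h]

end Sampling

end TensorRIP

open TensorRIP

theorem theorem4p1 :
    ∃ C₄ C₅ : ℝ, 0 < C₄ ∧ 0 < C₅ ∧
      ∀ (M N : ℕ) (I : Fin M → ℕ) (J : Fin N → ℕ),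
        2 ≤ ∏ i, I i → ∏ i, I i ≤ ∏ j, J j →
      ∀ (U : TensorRIP.BiTensor (TensorRIP.MultiIndex J) J), TensorRIP.IsUnitaryTensor U →
      ∀ Υ : ℝ, 1 ≤ Υ → (∀ i j, Real.sqrt (∏ k, (J k : ℝ)) * ‖U i j‖ ≤ Υ) →
      ∀ (Ω : Type*) [MeasurableSpace Ω] (μ : MeasureTheory.Measure Ω)
        [MeasureTheory.IsProbabilityMeasure μ] (θ : TensorRIP.MultiIndex J → Ω → ℝ),
        TensorRIP.IsBernoulliSelectors μ ((∏ i, (I i : ℝ)) / ∏ j, (J j : ℝ)) θ →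
      ∀ ξ : ℕ, 2 ≤ ξ → ∀ τ η : ℝ, 0 < τ → τ < 1 → 0 < η → η < 1 →
        (ξ : ℝ) * Υ ^ 2 * (τ ^ 2)⁻¹ *
            max (C₄ * Real.log ξ ^ 2 * Real.log (∏ i, (I i : ℝ)) * Real.log (∏ j, (J j : ℝ)))
              (C₅ * Real.log η⁻¹) ≤ ∏ i, (I i : ℝ) →
        μ.real {ω | τ ≤ TensorRIP.restrictedIsometryConstant ξ
          (TensorRIP.sampledTensor I (TensorRIP.selectedSet θ ω) U)} ≤ η := by
  have hmc : 0 < momentConst := by norm_num [momentConst]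
  refine ⟨1762560 * momentConst, 25920 * momentConst, by positivity, by positivity, ?_⟩
  intro M N I J hI hIJ U hU Υ hΥ hUΥ Ω _ μ _ θ hθ ξ hξ τ η hτ0 hτ1 hη0 hη1 h
  have hcard : ((Fintype.card (MultiIndex J) : ℕ) : ℝ) = ∏ k, (J k : ℝ) := by
    simp [MultiIndex]
  set m : ℝ := ∏ i, (I i : ℝ) with hm
  have hm2 : 2 ≤ m := by rw [hm]; exact_mod_cast hI
  have hmn : m ≤ Fintype.card (MultiIndex J) := by
    rw [hcard, hm]; exact_mod_cast hIJ
  have hm0 : 0 < m := by linarith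
  rw [← hcard] at hUΥ hθ h
  have : Nonempty (MultiIndex J) := by
    refine Fintype.card_pos_iff.1 ?_
    have : (0 : ℝ) < Fintype.card (MultiIndex J) := by linarith
    exact_mod_cast this
  set n : ℝ := (Fintype.card (MultiIndex J) : ℝ) with hn
  have hn0 : 0 < n := by linarith
  classical
  -- The patterns for which the restricted isometry constant is at least `τ`.
  let s : Finset (MultiIndex J → Bool) := Finset.univ.filter fun a =>
    ∃ ω, τ ≤ restrictedIsometryConstant ξ (sampledTensor I (selectedSet θ ω) U) ∧
      ∀ j, (θ j ω = 1 ↔ a j = true)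
  have hcover : {ω | τ ≤ restrictedIsometryConstant ξ (sampledTensor I (selectedSet θ ω) U)}
      ⊆ ⋃ a ∈ s, {ω | ∀ j, (θ j ω = 1 ↔ a j = true)} := by
    intro ω hω
    simp only [Set.mem_iUnion]
    have hpat : ∀ j, (θ j ω = 1 ↔ (fun j => decide (θ j ω = 1)) j = true) := fun j => by simp
    exact ⟨fun j => decide (θ j ω = 1), Finset.mem_filter.2 ⟨Finset.mem_univ _, ω, hω, hpat⟩, hpat⟩
  calc _ ≤ μ.real (⋃ a ∈ s, {ω | ∀ j, (θ j ω = 1 ↔ a j = true)}) :=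
        MeasureTheory.measureReal_mono hcover (MeasureTheory.measure_ne_top μ _)
    _ ≤ ∑ a ∈ s, μ.real {ω | ∀ j, (θ j ω = 1 ↔ a j = true)} :=
        MeasureTheory.measureReal_biUnion_finset_le _ _
    _ = ∑ a ∈ s, bernoulliWeight (m / n) a :=
        Finset.sum_congr rfl fun a _ => measureReal_pattern_eq μ hθ a
    _ ≤ η := by
        refine sum_bernoulliWeight_of_distortion_le hU.1 hm2 hmn hΥ hUΥ hξ hτ0 hτ1 hη0 hη1 h s ?_
        intro a ha t ht
        obtain ⟨-, ω, hω, hpat⟩ := Finset.mem_filter.1 ha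
        by_contra! hcon
        have hleast := isLeast_restrictedIsometryConstant (ξ := ξ) (by omega)
          (sampledTensor I (selectedSet θ ω) U)
        have hmem : t ∈ isometryBounds ξ (sampledTensor I (selectedSet θ ω) U) := by
          intro X hX
          have h1 := hcon X hX
          rw [frobeniusNorm_sampledTensor_sq I θ ω a hpat, frobeniusNorm_sq, ← hcard, ← hm]
          have h2 : ∑ j, (indic (a j) - m / n) * (n / m * ‖U.mulVec X j‖ ^ 2)
              = ∑ j, indic (a j) * (n / m * ‖U.mulVec X j‖ ^ 2) - ∑ j, ‖X j‖ ^ 2 := by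
            rw [← sum_norm_sq_mulVec_of_unitary hU.1 X, ← Finset.sum_sub_distrib]
            refine Finset.sum_congr rfl fun j _ => ?_
            field_simp
          rw [h2, abs_le] at h1
          constructor <;> linarith [h1.1, h1.2]
        have := hleast.2 hmem
        linarith [show τ ≤ _ from hω]
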